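/- Fix a nonempty finite alphabet $\Sigma$ and a countably infinite set $D$ of data values (concretely, the finite binary strings). A \emph{data word} is a word over $\Sigma\times D$. A \emph{data graph} is a pair $(V,E)$ with $V$ a finite set of vertices and $E\subseteq V\times\Sigma\times D\times V$ a finite set of labeled edges. \emph{Regular expressions with binding} (REWBs) are given by $$r ::= \varepsilon \mid a \mid a[c] \mid r+r \mid r\cdot r\mid r^*\mid a{\downarrow_x}(r),$$ where $a\in\Sigma$, $x$ is a variable, and $c$ is a Boolean combination of conditions $x^{=}$, $x^{\neq}$. For a partial valuation $\nu$ of the variables that is defined on the free variables of $r$, the language $L(r,\nu)$ of data words is defined as usual for $\varepsilon,+,\cdot,{}^*$, with $L(a,\nu)=\{\binom{a}{d}: d\in D\}$, $L(a[c],\nu)=\{\binom{a}{d}: d,\nu\models c\}$ (where $d,\nu\models x^{=}$ iff $\nu(x)=d$, and $d,\nu\models x^{\ne}$ iff $\nu(x)\neq d$) and $L(a{\downarrow_x}(r),\nu)=\bigcup_{d\in D}\{\binom{a}{d}\}\cdot L(r,\nu[x\to d])$. The levels are defined by $$F_0 ::= \varepsilon\mid a\mid a[c]\mid F_0+F_0\mid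 F_0\cdot F_0\mid F_0^*,\qquad E_i ::= F_{i-1}\mid E_i+E_i\mid E_i\cdot E_i\mid a{\downarrow_x}(E_i),\qquad F_i ::= E_i\mid F_i+F_i\mid F_i\cdot F_i\mid F_i^*\qquad(i\ge 1).$$ An instance of the \emph{evaluation problem for $E_1$ queries} consists of a data graph $G$, an REWB $e$ in $E_1$, a valuation $\nu$ (with finite domain) defined on the free variables of $e$, and two vertices $u,v$ of $G$; the question is whether some path of $G$ from $u$ to $v$ is labeled by a data word in $L(e,\nu)$. The parameter is the size of the query, i.e. the length of $e$ written as a string, names of variables included. A parameterized problem is a set of pairs $(x,k)$ of a string $x$ over a finite alphabet and a number $k\in\mathbb N$. An \emph{FPT reduction} from $Q$ to $Q'$ is a map $R$ such that (1) $(x,k)\in Q$ iff $R(x,k)\in Q'$; (2) there is a computable $g:\mathbb N\to\mathbb N$ such that $R(x,k)=(x',k')$ implies $k'\le g(k)$; (3) $R$ is computed by a Turing machine in time at most $f(k)\,(|x|+1)^c$, for some computable $f:\mathbb N\to\mathbb N$ and constant $c\in\mathbb N$. \emph{Weighted satisfiability} is the problem whether a given Boolean formula $\varphi$ has a satisfying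 truth assignment to the atoms occurring in $\varphi$ that sets exactly $k$ atoms to true; its parameter is $k$. The class $\mathrm{W[SAT]}$ consists of all parameterized problems that are FPT-reducible to weighted satisfiability. \textbf{Theorem.} The evaluation problem for $E_1$ queries over $\Sigma$, parameterized by the size of the query, is hard for $\mathrm{W[SAT]}$ under FPT reductions: every parameterized problem in $\mathrm{W[SAT]}$ is FPT-reducible to it. -/

import Mathlib

/-- Names are finite binary strings.  They serve as propositional atoms, data values, expression
variables and vertices of data graphs, so that every finite object below has a finite encoding. -/
abbrev Name : Type := List Bool

/-! ### Parameterized problems and FPT reductions -/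

/-- A parameterized problem over the alphabet `Γ`: a set of pairs `(x, k)` of a string and a
parameter. -/
abbrev ParamProblem (Γ : Type) : Type := Set (List Γ × ℕ)

/-- The pair `(x, k)` as a string: `k` in unary (the symbol `none`), followed by `x`. -/
def encodePair {Γ : Type} (p : List Γ × ℕ) : List (Option Γ) :=
  List.replicate p.2 none ++ p.1.map some

/-- The Turing machine `M` computes the map `R`, and it halts on `(x, k)` after at most
`T (x, k)` steps. -/
def ComputesWithin {Γ Δ : Type} (M : Turing.TM2ComputableAux (Option Γ) (Option Δ))
    (R : List Γ × ℕ → List Δ × ℕ) (T : List Γ × ℕ → ℕ) : Prop :=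
  ∀ p : List Γ × ℕ, Nonempty (Turing.TM2OutputsInTime M.tm
    ((encodePair p).map M.inputAlphabet.symm)
    (some ((encodePair (R p)).map M.outputAlphabet.symm)) (T p))

/-- `R` is an FPT reduction from `Q` to `Q'`. -/
structure IsFPTReduction {Γ Δ : Type} (Q : ParamProblem Γ) (Q' : ParamProblem Δ)
    (R : List Γ × ℕ → List Δ × ℕ) : Prop where
  /-- yes-instances correspond to yes-instances -/
  correct : ∀ p, p ∈ Q ↔ R p ∈ Q'
  /-- the new parameter is bounded by a computable function of the old one -/
  param_le : ∃ g : ℕ → ℕ, Computable g ∧ ∀ p, (R p).2 ≤ g p.2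
  /-- `R` is computable in time `f(k) * (|x| + 1) ^ c` with `f` computable and `c` constant -/
  fpt_time : ∃ (M : Turing.TM2ComputableAux (Option Γ) (Option Δ)) (f : ℕ → ℕ) (c : ℕ),
    Computable f ∧ ComputesWithin M R (fun p => f p.2 * (p.1.length + 1) ^ c)

/-- `Q` is FPT-reducible to `Q'`. -/
def FPTReducible {Γ Δ : Type} (Q : ParamProblem Γ) (Q' : ParamProblem Δ) : Prop :=
  ∃ R : List Γ × ℕ → List Δ × ℕ, IsFPTReduction Q Q' R

/-! ### Weighted satisfiability and the class W[SAT] -/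

/-- Boolean formulas. -/
inductive BoolFormula : Type
  | atom (s : Name)
  | neg (φ : BoolFormula)
  | conj (φ ψ : BoolFormula)
  | disj (φ ψ : BoolFormula)

/-- The alphabet in which Boolean formulas are written. -/
inductive FormulaSymbol : Type
  | bit (b : Bool)
  | endName
  | neg
  | conj
  | disj

namespace BoolFormula

/-- The propositional atoms occurring in a formula. -/
def atoms : BoolFormula → Finset Name
  | atom s => {s}
  | neg φ => φ.atoms
  | conj φ ψ => φ.atoms ∪ ψ.atoms
  | disj φ ψ => φ.atoms ∪ ψ.atoms

/-- The truth assignment that sets exactly the atoms in `S` to true satisfies the formula. -/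
def Sat (S : Finset Name) : BoolFormula → Prop
  | atom s => s ∈ S
  | neg φ => ¬ φ.Sat S
  | conj φ ψ => φ.Sat S ∧ ψ.Sat S
  | disj φ ψ => φ.Sat S ∨ ψ.Sat S

/-- A formula written as a string, in prefix notation. -/
def encode : BoolFormula → List FormulaSymbol
  | atom s => s.map FormulaSymbol.bit ++ [FormulaSymbol.endName]
  | neg φ => FormulaSymbol.neg :: φ.encode
  | conj φ ψ => FormulaSymbol.conj :: (φ.encode ++ ψ.encode)
  | disj φ ψ => FormulaSymbol.disj :: (φ.encode ++ ψ.encode)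

end BoolFormula

/-- Weighted satisfiability: a Boolean formula `φ` and the parameter `k`; is there a satisfying
truth assignment to the atoms of `φ` that sets exactly `k` of them to true? -/
def weightedSat : ParamProblem FormulaSymbol :=
  {p | ∃ φ : BoolFormula, p.1 = φ.encode ∧ ∃ S ⊆ φ.atoms, S.card = p.2 ∧ φ.Sat S}

/-- The class W[SAT]: the parameterized problems that are FPT-reducible to weighted
satisfiability. -/
def WSAT (Γ : Type) : Set (ParamProblem Γ) :=
  {Q | FPTReducible Q weightedSat}

/-- `P` is hard for W[SAT] under FPT reductions. -/
def IsWSATHard {Δ : Type} (P : ParamProblem Δ) : Prop :=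
  ∀ (Γ : Type) [Finite Γ] (Q : ParamProblem Γ), Q ∈ WSAT Γ → FPTReducible Q P

/-! ### Regular expressions with binding -/

/-- Conditions: Boolean combinations of `x^=` and `x^≠`. -/
inductive Condition : Type
  | eq (x : Name)
  | ne (x : Name)
  | not (c : Condition)
  | and (c₁ c₂ : Condition)
  | or (c₁ c₂ : Condition)

/-- Partial valuations of the variables by data values. -/
abbrev DataValuation : Type := Name → Option Name

namespace Condition

/-- The variables of a condition. -/
def vars : Condition → Finset Name
  | eq x => {x}
  | ne x => {x}
  | not c => c.vars
  | and c₁ c₂ => c₁.vars ∪ c₂.vars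
  | or c₁ c₂ => c₁.vars ∪ c₂.vars

/-- `c.Holds d ν` is `d, ν ⊨ c`. -/
def Holds (d : Name) (ν : DataValuation) : Condition → Prop
  | eq x => ν x = some d
  | ne x => ν x ≠ some d
  | not c => ¬ c.Holds d ν
  | and c₁ c₂ => c₁.Holds d ν ∧ c₂.Holds d ν
  | or c₁ c₂ => c₁.Holds d ν ∨ c₂.Holds d ν

end Condition

/-- Regular expressions with binding over the finite alphabet `A`; `bind a x r` is `a ↓ₓ (r)`. -/
inductive REWB (A : Type) : Type
  | eps
  | letter (a : A)
  | test (a : A) (c : Condition)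
  | plus (r₁ r₂ : REWB A)
  | cat (r₁ r₂ : REWB A)
  | star (r : REWB A)
  | bind (a : A) (x : Name) (r : REWB A)

/-- Data words are words over `A × Name`: letters paired with data values. -/
abbrev DataWord (A : Type) : Type := List (A × Name)

namespace REWB

variable {A : Type}

/-- The free variables of an expression. -/
def fv : REWB A → Finset Name
  | eps => ∅
  | letter _ => ∅
  | test _ c => c.vars
  | plus r₁ r₂ => r₁.fv ∪ r₂.fv
  | cat r₁ r₂ => r₁.fv ∪ r₂.fv
  | star r => r.fv
  | bind _ x r => r.fv.erase x

/-- The valuation is defined on all free variables of the expression. -/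
def Compatible (ν : DataValuation) (r : REWB A) : Prop :=
  ∀ x ∈ r.fv, (ν x).isSome

/-- The data language `L(r, ν)`. -/
def lang : REWB A → DataValuation → Language (A × Name)
  | eps, _ => 1
  | letter a, _ => {w : DataWord A | ∃ d, w = [(a, d)]}
  | test a c, ν => {w : DataWord A | ∃ d, c.Holds d ν ∧ w = [(a, d)]}
  | plus r₁ r₂, ν => r₁.lang ν + r₂.lang ν
  | cat r₁ r₂, ν => r₁.lang ν * r₂.lang ν
  | star r, ν => KStar.kstar (r.lang ν)
  | bind a x r, ν => {w : DataWord A |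
      ∃ d, ∃ w' ∈ r.lang (Function.update ν x (some d)), w = (a, d) :: w'}

mutual

/-- `LevelF i r`: the expression `r` is generated by `F_i`. -/
inductive LevelF : ℕ → REWB A → Prop
  | eps : LevelF 0 eps
  | letter (a : A) : LevelF 0 (letter a)
  | test (a : A) (c : Condition) : LevelF 0 (test a c)
  | ofE {i : ℕ} {r : REWB A} : LevelE (i + 1) r → LevelF (i + 1) r
  | plus {i : ℕ} {r₁ r₂ : REWB A} : LevelF i r₁ → LevelF i r₂ → LevelF i (plus r₁ r₂)
  | cat {i : ℕ} {r₁ r₂ : REWB A} : LevelF i r₁ → LevelF i r₂ → LevelF i (cat r₁ r₂)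
  | star {i : ℕ} {r : REWB A} : LevelF i r → LevelF i (star r)

/-- `LevelE i r`: the expression `r` is generated by `E_i` (for `i ≥ 1`; `E_0` is empty). -/
inductive LevelE : ℕ → REWB A → Prop
  | ofF {i : ℕ} {r : REWB A} : LevelF i r → LevelE (i + 1) r
  | plus {i : ℕ} {r₁ r₂ : REWB A} : LevelE i r₁ → LevelE i r₂ → LevelE i (plus r₁ r₂)
  | cat {i : ℕ} {r₁ r₂ : REWB A} : LevelE i r₁ → LevelE i r₂ → LevelE i (cat r₁ r₂)
  | bind {i : ℕ} {r : REWB A} (a : A) (x : Name) : LevelE i r → LevelE i (bind a x r)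

end

end REWB

/-! ### Data graphs -/

/-- A data graph over `A`: a finite set of vertices and a finite set of edges `(u, a, d, v)` from
`u` to `v` labeled by the letter `a` and the data value `d`. -/
structure DataGraph (A : Type) : Type where
  V : Finset Name
  E : Finset (Name × A × Name × Name)
  src_mem : ∀ {u a d v}, (u, a, d, v) ∈ E → u ∈ V
  tgt_mem : ∀ {u a d v}, (u, a, d, v) ∈ E → v ∈ V

/-- `G.DataPath u w v`: some path from `u` to `v` in `G` is labeled by the data word `w`. -/
inductive DataGraph.DataPath {A : Type} (G : DataGraph A) : Name → DataWord A → Name → Prop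
  | nil {u : Name} : u ∈ G.V → G.DataPath u [] u
  | cons {u v t : Name} {a : A} {d : Name} {w : DataWord A} :
      (u, a, d, v) ∈ G.E → G.DataPath v w t → G.DataPath u ((a, d) :: w) t

/-! ### The query evaluation problem -/

/-- The alphabet in which instances of the query evaluation problem are written. -/
inductive QuerySymbol (A : Type) : Type
  | bit (b : Bool)
  | endName
  | letter (a : A)
  | item
  | endList
  | condEq
  | condNe
  | condNot
  | condAnd
  | condOr
  | eps
  | test
  | plus
  | cat
  | star
  | bind

section Encoding

variable {A : Type}

/-- A name written as a string. -/
def encodeName (s : Name) : List (QuerySymbol A) :=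
  s.map QuerySymbol.bit ++ [QuerySymbol.endName]

/-- A list written as a string. -/
def encodeList {α : Type} (enc : α → List (QuerySymbol A)) (l : List α) : List (QuerySymbol A) :=
  l.flatMap (fun t => QuerySymbol.item :: enc t) ++ [QuerySymbol.endList]

/-- An edge of a data graph written as a string. -/
def encodeEdge (t : Name × A × Name × Name) : List (QuerySymbol A) :=
  encodeName t.1 ++ QuerySymbol.letter t.2.1 :: (encodeName t.2.2.1 ++ encodeName t.2.2.2)

/-- A pair of a variable and its data value written as a string. -/
def encodeBinding (t : Name × Name) : List (QuerySymbol A) :=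
  encodeName t.1 ++ encodeName t.2

/-- A condition written as a string, in prefix notation. -/
def Condition.encode : Condition → List (QuerySymbol A)
  | .eq x => QuerySymbol.condEq :: encodeName x
  | .ne x => QuerySymbol.condNe :: encodeName x
  | .not c => QuerySymbol.condNot :: c.encode
  | .and c₁ c₂ => QuerySymbol.condAnd :: (c₁.encode ++ c₂.encode)
  | .or c₁ c₂ => QuerySymbol.condOr :: (c₁.encode ++ c₂.encode)

/-- An expression written as a string, in prefix notation. -/
def REWB.encode : REWB A → List (QuerySymbol A)
  | .eps => [QuerySymbol.eps]
  | .letter a => [QuerySymbol.letter a]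
  | .test a c => QuerySymbol.test :: QuerySymbol.letter a :: c.encode
  | .plus r₁ r₂ => QuerySymbol.plus :: (r₁.encode ++ r₂.encode)
  | .cat r₁ r₂ => QuerySymbol.cat :: (r₁.encode ++ r₂.encode)
  | .star r => QuerySymbol.star :: r.encode
  | .bind a x r => QuerySymbol.bind :: QuerySymbol.letter a :: (encodeName x ++ r.encode)

/-- The size of an expression: the length of the string that represents it. -/
def REWB.size (r : REWB A) : ℕ := (r.encode).length

end Encoding

/-- An instance of the query evaluation problem: a data graph, an expression, a valuation of its
free variables, and two vertices. -/
structure QueryInstance (A : Type) : Type where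
  graph : DataGraph A
  expr : REWB A
  val : DataValuation
  source : Name
  target : Name
  compatible : expr.Compatible val
  source_mem : source ∈ graph.V
  target_mem : target ∈ graph.V

namespace QueryInstance

variable {A : Type}

/-- The instance is a yes-instance: `source` is connected to `target` by a data path in
`L(expr, val)`. -/
def IsYes (I : QueryInstance A) : Prop :=
  ∃ w ∈ I.expr.lang I.val, I.graph.DataPath I.source w I.target

/-- The string `x` represents the instance `I`: it lists the vertices and the edges of the graph
(in any order), the expression, the values of finitely many variables (all others being undefined),
and the two vertices. -/
def EncodedBy (I : QueryInstance A) (x : List (QuerySymbol A)) : Prop :=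
  ∃ (vs : List Name) (es : List (Name × A × Name × Name)) (bs : List (Name × Name)),
    (∀ u, u ∈ vs ↔ u ∈ I.graph.V) ∧ (∀ t, t ∈ es ↔ t ∈ I.graph.E) ∧
    (∀ y, I.val y = bs.lookup y) ∧
    x = encodeList encodeName vs ++ encodeList encodeEdge es ++ I.expr.encode ++
      encodeList encodeBinding bs ++ encodeName I.source ++ encodeName I.target

end QueryInstance

/-- Evaluating `E_i` queries over the finite alphabet `A`, parameterized by the size of the
query. -/
def evalE (A : Type) (i : ℕ) : ParamProblem (QuerySymbol A) :=
  {p | ∃ I : QueryInstance A, REWB.LevelE i I.expr ∧ I.EncodedBy p.1 ∧ p.2 = I.expr.size ∧ I.IsYes}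

-- Given a formula φ and a number k, the data graph is a branching program for φ that reads the
-- truth values of the atoms from the data, and the query, whose size depends on k only, guesses the
-- k true atoms. An atom p becomes the data value `true :: p`. The values `[]` and `[false]` are
-- markers for the answers "true" and "false", and `[]` is also the value of the only free variable,
-- number 0.
--
-- The query binds k variables in turn. Each bound value has to be repeated at once and has to
-- differ from `[]` and from the earlier ones. Then follows a star over pairs of a value and a
-- marker, where the marker is `[]` exactly if the value is `[]` or one of the bound ones. No binder
-- lies under the star, so the query is in E_1.
--
-- The start vertex 0 carries, for every atom p, a cycle of two edges labeled `true :: p`. From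
-- there, nothing else reads a value `true :: p` twice in succession, so the binding phase picks k
-- distinct atoms and ends where it began. Each occurrence of an atom p has an edge labeled `true ::
-- p` to a mid vertex, from which `[]` leads to the exit for "true" and `[false]` to the exit for
-- "false"; the star enforces the exit that agrees with the guess. Negation swaps the exits, and
-- conjunction and disjunction need one fresh vertex each, as in short-circuit evaluation. Hence the
-- exit 1 is reachable if and only if some assignment of weight k satisfies φ
-- (`isYes_formulaInstance`). The language side is `mem_lang_wrap` and `mem_lang_starPart`; the
-- graph side is `dataPath_doubled`, `exists_dataPath` and the invariant of `exists_edgeClosed`.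
--
-- The rest is complexity. A problem in W[SAT] comes with a machine for a reduction to weighted
-- satisfiability, and one stack machine runs it and then translates its output. Formulas are in
-- prefix notation, so one pass with a stack of pending subformulas emits the edges and detects
-- strings that are not formulas; those are sent to parameter 0, which no query has. The translation
-- takes cubic time (`Frag.runs_reductionCmd`), and the intermediate output is short because a
-- machine pushes boundedly many symbols per step (`Frag.length_output_le`).

open Turing

/-! ### Program fragments for stack machines -/

namespace Turing.TM2

variable {K : Type} {Γ : K → Type} {Λ Λ' σ : Type}

/-- Rename the labels of a statement. -/
def Stmt.mapLabel (h : Λ → Λ') : Stmt Γ Λ σ → Stmt Γ Λ' σ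
  | .push k f q => .push k f (q.mapLabel h)
  | .peek k f q => .peek k f (q.mapLabel h)
  | .pop k f q => .pop k f (q.mapLabel h)
  | .load f q => .load f (q.mapLabel h)
  | .branch p q₁ q₂ => .branch p (q₁.mapLabel h) (q₂.mapLabel h)
  | .goto f => .goto (fun v => h (f v))
  | .halt => .halt

theorem stepAux_mapLabel [DecidableEq K] (h : Λ → Λ') (q : Stmt Γ Λ σ) (v : σ)
    (S : ∀ k, List (Γ k)) :
    stepAux (q.mapLabel h) v S =
      ⟨(stepAux q v S).l.map h, (stepAux q v S).var, (stepAux q v S).stk⟩ := by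
  induction q generalizing v S with
  | branch p q₁ q₂ h₁ h₂ => cases hp : p v <;> simp [Stmt.mapLabel, hp, h₁, h₂]
  | _ => simp_all [Stmt.mapLabel]

/-- An upper bound on the number of symbols that a statement pushes. -/
def Stmt.pushes : Stmt Γ Λ σ → ℕ
  | .push _ _ q => q.pushes + 1
  | .peek _ _ q => q.pushes
  | .pop _ _ q => q.pushes
  | .load _ q => q.pushes
  | .branch _ q₁ q₂ => q₁.pushes + q₂.pushes
  | .goto _ => 0
  | .halt => 0

theorem length_stepAux_le [DecidableEq K] (q : Stmt Γ Λ σ) (v : σ) (S : ∀ k, List (Γ k)) (k : K) :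
    ((stepAux q v S).stk k).length ≤ (S k).length + q.pushes := by
  induction q generalizing v S with
  | branch p q₁ q₂ h₁ h₂ =>
    have := h₁ v S
    have := h₂ v S
    cases hp : p v <;> simp only [stepAux, hp, cond, Stmt.pushes] <;> omega
  | push k' f q h =>
    refine (h v _).trans ?_
    rcases eq_or_ne k k' with rfl | hk
    · simp [Stmt.pushes]; omega
    · simp [Function.update_of_ne hk, Stmt.pushes]
  | pop k' f q h =>
    refine (h _ _).trans ?_
    rcases eq_or_ne k k' with rfl | hk
    · simp [Stmt.pushes]
    · simp [Function.update_of_ne hk, Stmt.pushes]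
  | _ => simp_all [Stmt.pushes]

/-- One step executes one statement and so adds at most `B` symbols to any stack. This is what
bounds the output of a machine by its running time. -/
theorem length_iterate_step_le [DecidableEq K] (M : Λ → Stmt Γ Λ σ) (B : ℕ)
    (hB : ∀ l, (M l).pushes ≤ B) (k : K) (n : ℕ) (c c' : Cfg Γ Λ σ)
    (h : (flip bind (step M))^[n] (some c) = some c') :
    (c'.stk k).length ≤ (c.stk k).length + n * B := by
  induction n generalizing c with
  | zero => simp at h; simp [h]
  | succ n ih =>
    rw [Function.iterate_succ_apply] at h
    rcases c with ⟨_ | l, v, S⟩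
    -- A halted configuration has no successor, so the iteration would end in `none` and not in
    -- `some c'`.
    · have hn : ∀ m, (flip bind (step M))^[m] (none : Option (Cfg Γ Λ σ)) = none := fun m => by
        induction m with
        | zero => rfl
        | succ m ih => rw [Function.iterate_succ_apply]; exact ih
      have h0 : flip bind (step M) (some ⟨none, v, S⟩) = none := rfl
      rw [h0, hn] at h
      simp at h
    · have h1 := ih _ h
      have h2 := length_stepAux_le (M l) v S k
      have h3 := hB l
      simp only at h1 h2 ⊢
      rw [add_mul]
      omega

end Turing.TM2

/-- A program fragment: a machine program whose statements may also jump to an exit, which is the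
label `none`. -/
structure Frag {K : Type} (Γ : K → Type) (σ : Type) where
  Λ : Type
  fin : Finite Λ
  entry : Λ
  code : Λ → TM2.Stmt Γ (Option Λ) σ

namespace Frag

section General

variable {K : Type} [DecidableEq K] {Γ : K → Type} {σ : Type}

/-- `F.Run o v S n v' S'`: started at the label `o`, the fragment reaches its exit after exactly
`n` steps. -/
inductive Run (F : Frag Γ σ) : Option F.Λ → σ → (∀ k, List (Γ k)) → ℕ → σ →
    (∀ k, List (Γ k)) → Prop
  | exit (v S) : Run F none v S 0 v S
  | step {l v S o v₁ S₁ n v' S'} : TM2.stepAux (F.code l) v S = ⟨some o, v₁, S₁⟩ →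
      Run F o v₁ S₁ n v' S' → Run F (some l) v S (n + 1) v' S'

/-- The common core of all control structures: `G` contains a copy of `F` along `e`, in which
leaving `F` means continuing at `x`. A run of `F` followed by a run of `G` from `x` is then a run of
`G`. -/
theorem Run.map {F G : Frag Γ σ} (e : F.Λ → G.Λ) (x : Option G.Λ)
    (he : ∀ l, G.code (e l) = (F.code l).mapLabel (fun o => o.elim x (fun l => some (e l))))
    {o v S n v₁ S₁ m v₂ S₂} (hF : F.Run o v S n v₁ S₁) (hG : G.Run x v₁ S₁ m v₂ S₂) :
    G.Run (o.elim x (fun l => some (e l))) v S (n + m) v₂ S₂ := by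
  induction hF with
  | exit v S => simpa using hG
  | step h _ ih =>
    have := ih hG
    rw [Nat.add_right_comm]
    refine Run.step (o := _) ?_ this
    rw [he, TM2.stepAux_mapLabel, h]
    rfl

/-- Run one fragment after the other. -/
def seq (F G : Frag Γ σ) : Frag Γ σ where
  Λ := F.Λ ⊕ G.Λ
  fin := by have := F.fin; have := G.fin; infer_instance
  entry := .inl F.entry
  code
    | .inl l => (F.code l).mapLabel
        (fun o => o.elim (some (Sum.inr G.entry)) (fun l => some (Sum.inl l)))
    | .inr l => (G.code l).mapLabel (fun o => o.elim none (fun l => some (Sum.inr l)))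

theorem Run.seq {F G : Frag Γ σ} {v S n v₁ S₁ m v₂ S₂}
    (hF : F.Run (some F.entry) v S n v₁ S₁) (hG : G.Run (some G.entry) v₁ S₁ m v₂ S₂) :
    (F.seq G).Run (some (F.seq G).entry) v S (n + m) v₂ S₂ :=
  hF.map (G := F.seq G) Sum.inl (some (Sum.inr G.entry)) (fun _ => rfl)
    (hG.map (G := F.seq G) Sum.inr none (fun _ => rfl) (Run.exit _ _))

end General

-- Fragments on additional stacks beside those of a given machine

section Joint

variable {K₁ K₂ : Type} [DecidableEq K₁] [DecidableEq K₂] {Γ₁ : K₁ → Type} {Sym : Type}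
  {σ₁ : Type}

/-- The alphabets of the stacks of a machine, together with further stacks over `Sym`. -/
abbrev joinΓ (Γ₁ : K₁ → Type) (K₂ Sym : Type) : K₁ ⊕ K₂ → Type
  | .inl k => Γ₁ k
  | .inr _ => Sym

/-- The contents of all stacks, from those of the two groups of stacks. -/
def stk (S₁ : ∀ k, List (Γ₁ k)) (S : K₂ → List Sym) : ∀ k, List (joinΓ Γ₁ K₂ Sym k)
  | .inl k => S₁ k
  | .inr k => S k

theorem update_stk_inr (S₁ : ∀ k, List (Γ₁ k)) (S : K₂ → List Sym) (k : K₂)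
    (w : List (joinΓ Γ₁ K₂ Sym (.inr k))) :
    Function.update (stk S₁ S) (.inr k) w = stk S₁ (Function.update S k w) := by
  funext k'
  rcases k' with k' | k'
  · exact Function.update_of_ne (by simp) _ _
  · rcases eq_or_ne k' k with rfl | h
    · exact (Function.update_self _ _ _).trans (Function.update_self k' w S).symm
    · exact (Function.update_of_ne (by simpa using h) _ _).trans
        (show S k' = Function.update S k w k' from (Function.update_of_ne h _ _).symm)

theorem update_stk_inl (S₁ : ∀ k, List (Γ₁ k)) (S : K₂ → List Sym) (k : K₁)
    (w : List (joinΓ Γ₁ K₂ Sym (.inl k))) :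
    Function.update (stk S₁ S) (.inl k) w = stk (Function.update S₁ k w) S := by
  funext k'
  rcases k' with k' | k'
  · rcases eq_or_ne k' k with rfl | h
    · exact (Function.update_self _ _ _).trans (Function.update_self k' w S₁).symm
    · exact (Function.update_of_ne (by simpa using h) _ _).trans
        (show S₁ k' = Function.update S₁ k w k' from (Function.update_of_ne h _ _).symm)
  · exact Function.update_of_ne (by simp) _ _

/-- Fragments that work on the stacks `K₂` over the alphabet `Sym`, and may keep the last popped
symbol. -/
abbrev JFrag {K₁ : Type} (Γ₁ : K₁ → Type) (K₂ Sym σ₁ : Type) := Frag (joinΓ Γ₁ K₂ Sym) (σ₁ × Option Sym)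

/-- The fragment transforms the contents `S` of the stacks `K₂` into `S'`, within `n` steps. -/
def Runs (F : JFrag Γ₁ K₂ Sym σ₁) (S : K₂ → List Sym) (n : ℕ) (S' : K₂ → List Sym) : Prop :=
  ∀ v S₁, ∃ v', ∃ m ≤ n, F.Run (some F.entry) v (stk S₁ S) m v' (stk S₁ S')

theorem Runs.mono {F : JFrag Γ₁ K₂ Sym σ₁} {S S' n n'} (h : F.Runs S n S') (hn : n ≤ n') :
    F.Runs S n' S' := fun v S₁ =>
  have ⟨v', m, hm, hr⟩ := h v S₁
  ⟨v', m, hm.trans hn, hr⟩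

theorem Runs.seq {F G : JFrag Γ₁ K₂ Sym σ₁} {S n S₁ m S₂} (hF : F.Runs S n S₁)
    (hG : G.Runs S₁ m S₂) : (F.seq G).Runs S (n + m) S₂ := fun v T =>
  have ⟨v', m₁, hm₁, hr₁⟩ := hF v T
  have ⟨v'', m₂, hm₂, hr₂⟩ := hG v' T
  ⟨v'', m₁ + m₂, add_le_add hm₁ hm₂, hr₁.seq hr₂⟩

/-- Push a symbol. -/
def push (k : K₂) (s : Sym) : JFrag Γ₁ K₂ Sym σ₁ where
  Λ := Unit
  fin := inferInstance
  entry := ()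
  code _ := .push (.inr k) (fun _ => s) (.goto fun _ => none)

theorem runs_push (k : K₂) (s : Sym) (S : K₂ → List Sym) :
    (push k s : JFrag Γ₁ K₂ Sym σ₁).Runs S 1 (Function.update S k (s :: S k)) := fun v S₁ => by
  refine ⟨v, 1, le_rfl, Run.step ?_ (Run.exit _ _)⟩
  simp only [push, TM2.stepAux]
  congr 1
  exact update_stk_inr S₁ S k _

/-- Pop a symbol and choose the continuation accordingly. -/
def casePop [Finite Sym] (k : K₂) (f : Option Sym → JFrag Γ₁ K₂ Sym σ₁) :
    JFrag Γ₁ K₂ Sym σ₁ where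
  Λ := Option (Σ o, (f o).Λ)
  fin := by have := fun o => (f o).fin; infer_instance
  entry := none
  code
    | none => .pop (.inr k) (fun v o => (v.1, o))
        (.goto fun v => some (some ⟨v.2, (f v.2).entry⟩))
    | some ⟨o, l⟩ => ((f o).code l).mapLabel (fun x => x.elim none (fun l => some (some ⟨o, l⟩)))

theorem runs_casePop [Finite Sym] {k : K₂} {f : Option Sym → JFrag Γ₁ K₂ Sym σ₁}
    {S n S'} (h : (f (S k).head?).Runs (Function.update S k (S k).tail) n S') :
    (casePop k f).Runs S (n + 1) S' := fun v S₁ => by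
  obtain ⟨v', m, hm, hr⟩ := h (v.1, (S k).head?) S₁
  have hr' : (casePop k f).Run (some (some ⟨_, (f _).entry⟩)) _ _ m _ _ :=
    hr.map (G := casePop k f) (fun l => some ⟨_, l⟩) none (fun _ => rfl) (Run.exit _ _)
  refine ⟨v', m + 1, Nat.succ_le_succ hm, Run.step ?_ hr'⟩
  simp only [casePop, TM2.stepAux]
  congr 1
  exact update_stk_inr S₁ S k _

/-- Pop symbols, each of them followed by the chosen continuation, until the stack is empty or a
final symbol appears. The stack may belong to any group. -/
def loopOn [Finite Sym] (κ : K₁ ⊕ K₂) (read : joinΓ Γ₁ K₂ Sym κ → Sym) (stops : Sym → Bool)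
    (f : Sym → JFrag Γ₁ K₂ Sym σ₁) : JFrag Γ₁ K₂ Sym σ₁ where
  Λ := Option (Σ s, (f s).Λ)
  fin := by have := fun s => (f s).fin; infer_instance
  entry := none
  code
    | none => .pop κ (fun v o => (v.1, o.map read))
        (.goto fun v => v.2.elim none
          (fun s => bif stops s then none else some (some ⟨s, (f s).entry⟩)))
    | some ⟨s, l⟩ => ((f s).code l).mapLabel
        (fun x => x.elim (some none) (fun l => some (some ⟨s, l⟩)))

variable [Finite Sym] {κ : K₁ ⊕ K₂} {read : joinΓ Γ₁ K₂ Sym κ → Sym} {stops : Sym → Bool}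
  {f : Sym → JFrag Γ₁ K₂ Sym σ₁}

theorem run_loopOn_nil {v S} (h : S κ = []) :
    (loopOn κ read stops f).Run (some none) v S 1 (v.1, none) S := by
  refine Run.step ?_ (Run.exit _ _)
  simp only [loopOn, TM2.stepAux, h]
  congr 1
  rw [Function.update_eq_self_iff, h]
  rfl

theorem run_loopOn_stop {v S s w} (h : S κ = s :: w) (hs : stops (read s) = true) :
    (loopOn κ read stops f).Run (some none) v S 1 (v.1, some (read s)) (Function.update S κ w) := by
  refine Run.step ?_ (Run.exit _ _)
  simp [loopOn, TM2.stepAux, h, hs]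

/-- One round of the loop: the body is embedded by `Run.map`, with its exit redirected to the head
of the loop; the additional step is the pop. -/
theorem run_loopOn_cons {v S s w n v₁ S₁ m v₂ S₂} (h : S κ = s :: w)
    (hs : stops (read s) = false)
    (hf : (f (read s)).Run (some (f (read s)).entry) (v.1, some (read s)) (Function.update S κ w)
      n v₁ S₁)
    (hr : (loopOn κ read stops f).Run (some none) v₁ S₁ m v₂ S₂) :
    (loopOn κ read stops f).Run (some none) v S (n + m + 1) v₂ S₂ := by
  have hr' : (loopOn κ read stops f).Run (some (some ⟨_, (f _).entry⟩)) _ _ (n + m) _ _ :=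
    hf.map (G := loopOn κ read stops f) (fun l => some ⟨_, l⟩) (some none) (fun _ => rfl) hr
  refine Run.step ?_ hr'
  simp [loopOn, TM2.stepAux, h, hs]

/-- Pop symbols from a stack of the second group, each of them followed by the chosen
continuation, until the stack is empty or a final symbol appears. -/
def loop (k : K₂) (stops : Sym → Bool) (f : Sym → JFrag Γ₁ K₂ Sym σ₁) : JFrag Γ₁ K₂ Sym σ₁ :=
  loopOn (.inr k) id stops f

theorem runs_loop_nil {k : K₂} {S} (h : S k = []) :
    (loop k stops f).Runs S 1 S := fun _ _ => ⟨_, 1, le_rfl, run_loopOn_nil h⟩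

theorem runs_loop_stop {k : K₂} {S s w} (h : S k = s :: w) (hs : stops s = true) :
    (loop k stops f).Runs S 1 (Function.update S k w) := fun v S₁ => by
  refine ⟨(v.1, some s), 1, le_rfl, ?_⟩
  rw [← update_stk_inr]
  exact run_loopOn_stop (κ := .inr k) (read := id) (f := f) (v := v) (S := stk S₁ S) h hs

theorem runs_loop_cons {k : K₂} {S s w n S₁ m S₂} (h : S k = s :: w) (hs : stops s = false)
    (hf : (f s).Runs (Function.update S k w) n S₁) (hr : (loop k stops f).Runs S₁ m S₂) :
    (loop k stops f).Runs S (n + m + 1) S₂ := fun v T => by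
  obtain ⟨v₁, n', hn', hf'⟩ := hf (v.1, some s) T
  obtain ⟨v₂, m', hm', hr'⟩ := hr v₁ T
  rw [← update_stk_inr] at hf'
  exact ⟨v₂, n' + m' + 1, by omega,
    run_loopOn_cons (κ := .inr k) (read := id) (S := stk T S) h hs hf' hr'⟩

end Joint

-- From machines to fragments and back

section Lift

variable {K₁ K₂ : Type} [DecidableEq K₁] [DecidableEq K₂] {Γ₁ : K₁ → Type} {Sym Λ₁ σ₁ : Type}

/-- A statement of a machine as a statement of a fragment: halting becomes leaving. -/
def liftStmt (K₂ Sym : Type) :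
    TM2.Stmt Γ₁ Λ₁ σ₁ → TM2.Stmt (joinΓ Γ₁ K₂ Sym) (Option Λ₁) (σ₁ × Option Sym)
  | .push k f q => .push (.inl k) (fun v => f v.1) (liftStmt K₂ Sym q)
  | .peek k f q => .peek (.inl k) (fun v o => (f v.1 o, v.2)) (liftStmt K₂ Sym q)
  | .pop k f q => .pop (.inl k) (fun v o => (f v.1 o, v.2)) (liftStmt K₂ Sym q)
  | .load f q => .load (fun v => (f v.1, v.2)) (liftStmt K₂ Sym q)
  | .branch p q₁ q₂ => .branch (fun v => p v.1) (liftStmt K₂ Sym q₁) (liftStmt K₂ Sym q₂)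
  | .goto f => .goto (fun v => some (f v.1))
  | .halt => .goto (fun _ => none)

theorem stepAux_liftStmt (q : TM2.Stmt Γ₁ Λ₁ σ₁) (v : σ₁) (o : Option Sym)
    (S₁ : ∀ k, List (Γ₁ k)) (S : K₂ → List Sym) :
    TM2.stepAux (liftStmt K₂ Sym q) (v, o) (stk S₁ S) =
      ⟨some (TM2.stepAux q v S₁).l, ((TM2.stepAux q v S₁).var, o),
        stk (TM2.stepAux q v S₁).stk S⟩ := by
  induction q generalizing v S₁ with
  | branch p q₁ q₂ h₁ h₂ => cases hp : p v <;> simp [liftStmt, hp, h₁, h₂]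
  | push k f q h =>
    simp only [liftStmt, TM2.stepAux]
    rw [← h]
    congr 1
    exact update_stk_inl S₁ S k _
  | pop k f q h =>
    simp only [liftStmt, TM2.stepAux]
    rw [← h]
    congr 1
    exact update_stk_inl S₁ S k _
  | peek k f q h =>
    simp only [liftStmt, TM2.stepAux]
    rw [← h]
    rfl
  | _ => simp_all [liftStmt]

end Lift

section Machine

variable {K₂ Sym : Type} [DecidableEq K₂]

/-- A machine as a fragment. -/
def ofMachine (M : FinTM2) (K₂ Sym : Type) : JFrag M.Γ K₂ Sym M.σ where
  Λ := M.Λ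
  fin := @Finite.of_fintype _ M.ΛFin
  entry := M.main
  code l := liftStmt K₂ Sym (M.m l)

/-- Lifting turns each statement into a single statement, so the number of steps is the same.
Halting, with label `none`, coincides with the exit of the fragment. -/
theorem run_ofMachine (M : FinTM2) (S : K₂ → List Sym) (o : Option Sym) (n : ℕ) (c c' : M.Cfg)
    (hc : c'.l = none) (h : (flip bind M.step)^[n] (some c) = some c') :
    (ofMachine M K₂ Sym).Run c.l (c.var, o) (stk c.stk S) n (c'.var, o) (stk c'.stk S) := by
  induction n generalizing c with
  | zero => simp at h; subst h; rw [hc]; exact Run.exit _ _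
  | succ n ih =>
    rw [Function.iterate_succ_apply] at h
    rcases c with ⟨_ | l, v, T⟩
    · have hn : ∀ m, (flip bind M.step)^[m] (none : Option M.Cfg) = none := fun m => by
        induction m with
        | zero => rfl
        | succ m ih => rw [Function.iterate_succ_apply]; exact ih
      have h0 : flip bind M.step (some (⟨none, v, T⟩ : M.Cfg)) = none := rfl
      rw [h0, hn] at h
      simp at h
    · exact Run.step (stepAux_liftStmt _ _ _ _ _) (ih _ h)

variable [Fintype K₂] [Finite Sym]

open Classical in
/-- The machine with the input stack of `M` and the output stack `out` that runs a fragment. -/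
noncomputable def toMachine (M : FinTM2) (F : JFrag M.Γ K₂ Sym M.σ) (out : K₂) : FinTM2 where
  K := M.K ⊕ K₂
  kDecidableEq := by have := M.kDecidableEq; infer_instance
  kFin := by have := M.kFin; infer_instance
  k₀ := .inl M.k₀
  k₁ := .inr out
  Γ := joinΓ M.Γ K₂ Sym
  Λ := Option F.Λ
  main := some F.entry
  ΛFin := by have := F.fin; exact Fintype.ofFinite _
  σ := M.σ × Option Sym
  initialState := (M.initialState, none)
  σFin := by have := M.σFin; exact Fintype.ofFinite _
  Γk₀Fin := M.Γk₀Fin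
  m
    | some l => F.code l
    | none => .load (fun _ => (M.initialState, none)) .halt

/-- The additional step is spent at the label `none`. It halts and also resets the internal state,
because the final configuration in `TM2OutputsInTime` has to carry the initial state. -/
theorem iterate_toMachine (M : FinTM2) (F : JFrag M.Γ K₂ Sym M.σ) (out : K₂)
    {o v S n v' S'} (h : F.Run o v S n v' S') :
    (flip bind (toMachine M F out).step)^[n + 1] (some ⟨some o, v, S⟩) =
      some ⟨none, (M.initialState, none), S'⟩ := by
  induction h with
  | exit => rfl
  | @step l v S o v₁ S₁ n v' S' h _ ih =>
    rw [Function.iterate_succ_apply, ← ih]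
    exact congrArg _ (congrArg some h)

theorem stk_initList_self (M : FinTM2) (s : List (M.Γ M.k₀)) : (initList M s).stk M.k₀ = s := by
  simp [initList]

theorem stk_initList_of_ne (M : FinTM2) (s : List (M.Γ M.k₀)) {k : M.K} (h : k ≠ M.k₀) :
    (initList M s).stk k = [] := by
  simp [initList, h]

theorem stk_haltList_self (M : FinTM2) (s : List (M.Γ M.k₁)) : (haltList M s).stk M.k₁ = s := by
  simp [haltList]

theorem stk_haltList_of_ne (M : FinTM2) (s : List (M.Γ M.k₁)) {k : M.K} (h : k ≠ M.k₁) :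
    (haltList M s).stk k = [] := by
  simp [haltList, h]

theorem toMachine_outputs (M : FinTM2) (F : JFrag M.Γ K₂ Sym M.σ) (out : K₂)
    (s : List (M.Γ M.k₀)) (s' : List Sym) {n v T}
    (h : F.Run (some F.entry) (M.initialState, none) (stk (initList M s).stk fun _ => []) n v
      (stk (fun _ => []) (Function.update (fun _ => []) out s'))) (hT : n + 1 ≤ T) :
    Nonempty (TM2OutputsInTime (toMachine M F out) s (some s') T) := by
  refine ⟨⟨⟨n + 1, ?_⟩, hT⟩⟩
  have hi : (initList (toMachine M F out) s).stk = stk (initList M s).stk fun _ => [] := by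
    funext k
    rcases k with k | k
    · by_cases hk : k = M.k₀
      · subst hk
        exact (stk_initList_self (toMachine M F out) s).trans (stk_initList_self M s).symm
      · exact (stk_initList_of_ne (toMachine M F out) s (k := .inl k)
          (fun h => hk (Sum.inl.inj h))).trans (stk_initList_of_ne M s hk).symm
    · exact stk_initList_of_ne (toMachine M F out) s (k := .inr k) (fun h => by cases h)
  have ho : (haltList (toMachine M F out) s').stk =
      stk (fun _ => []) (Function.update (fun _ => []) out s') := by
    funext k
    rcases k with k | k
    · exact stk_haltList_of_ne (toMachine M F out) s' (k := .inl k) (fun h => by cases h)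
    · by_cases hk : k = out
      · subst hk
        exact (stk_haltList_self (toMachine M F k) s').trans
          (show s' = Function.update (fun _ => []) k s' k by simp)
      · exact (stk_haltList_of_ne (toMachine M F out) s' (k := .inr k)
          (fun h => hk (Sum.inr.inj h))).trans
          (show [] = Function.update (fun _ => []) out s' k by simp [hk])
  rw [← hi, ← ho] at h
  exact iterate_toMachine M F out h

end Machine

end Frag

/-! ### The query and the data graph of a formula -/

/-- The number `n` in unary. -/
abbrev unary (n : ℕ) : Name := List.replicate n true

/-- The condition that the data value is the value of one of the variables `0, …, j`. -/
def posCond : ℕ → Condition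
  | 0 => .eq []
  | j + 1 => .or (.eq (unary (j + 1))) (posCond j)

-- The query and its language

section Query

variable {A : Type} (a : A)

/-- Pairs of a data value and a marker; the marker is the value of the variable `0` if and only if
the data value is the value of one of the variables `0, …, k`. -/
def starPart (k : ℕ) : REWB A :=
  .star (.plus (.cat (.test a (posCond k)) (.test a (.eq [])))
    (.cat (.test a (.not (posCond k))) (.test a (.ne []))))

/-- Bind the variables `1, …, j` to distinct values. -/
def wrap : ℕ → REWB A → REWB A
  | 0, r => r
  | j + 1, r => wrap j (.bind a (unary (j + 1))
      (.cat (.test a (.and (.eq (unary (j + 1))) (.not (posCond j)))) r))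

/-- The query that chooses `k` distinct values and evaluates a formula. -/
def query (k : ℕ) : REWB A := wrap a k (starPart a k)

theorem levelE_wrap (j : ℕ) (r : REWB A) (hr : REWB.LevelE 1 r) : REWB.LevelE 1 (wrap a j r) := by
  induction j generalizing r with
  | zero => exact hr
  | succ j ih => exact ih _ (.bind _ _ (.cat (.ofF (.test _ _)) hr))

/-- The star only contains tests, so it is generated by F_0; the binders around it use nothing
beyond the rules for E_1. -/
theorem levelE_query (k : ℕ) : REWB.LevelE 1 (query a k) :=
  levelE_wrap a k _ (.ofF (.star (.plus (.cat (.test _ _) (.test _ _))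
    (.cat (.test _ _) (.test _ _)))))

theorem vars_posCond {j : ℕ} {x : Name} (h : x ∈ (posCond j).vars) : ∃ i ≤ j, x = unary i := by
  induction j with
  | zero => exact ⟨0, le_rfl, by simpa [posCond, Condition.vars] using h⟩
  | succ j ih =>
    simp only [posCond, Condition.vars, Finset.mem_union, Finset.mem_singleton] at h
    rcases h with h | h
    · exact ⟨j + 1, le_rfl, h⟩
    · obtain ⟨i, hi, h⟩ := ih h
      exact ⟨i, by omega, h⟩

theorem fv_wrap (j : ℕ) (r : REWB A) (hr : ∀ x ∈ r.fv, ∃ i ≤ j, x = unary i) :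
    ∀ x ∈ (wrap a j r).fv, x = [] := by
  induction j generalizing r with
  | zero => simpa [wrap] using hr
  | succ j ih =>
    apply ih
    intro x hx
    simp only [REWB.fv, Condition.vars, Finset.mem_erase, Finset.mem_union,
      Finset.mem_singleton] at hx
    obtain ⟨hx, (h | h) | h⟩ := hx
    · exact absurd h hx
    · exact vars_posCond h
    · obtain ⟨i, hi, rfl⟩ := hr x h
      refine ⟨i, ?_, rfl⟩
      have : i ≠ j + 1 := fun h => hx (by rw [h])
      omega

theorem fv_query (k : ℕ) : ∀ x ∈ (query a k).fv, x = [] := by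
  apply fv_wrap
  intro x hx
  simp only [starPart, REWB.fv, Condition.vars, Finset.mem_union, Finset.mem_singleton] at hx
  obtain (h | h) | h | h := hx
  · exact vars_posCond h
  · exact ⟨0, by simp, h⟩
  · exact vars_posCond h
  · exact ⟨0, by simp, h⟩

/-- The valuation that gives the values in `l` to the variables `0, 1, …`. -/
def valOf (l : List Name) : DataValuation :=
  fun x => if x = unary x.length then l[x.length]? else none

theorem valOf_unary (l : List Name) (i : ℕ) : valOf l (unary i) = l[i]? := by
  simp [valOf]

theorem valOf_nil (l : List Name) : valOf l [] = l.head? := by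
  simp [valOf, List.head?_eq_getElem?]

theorem valOf_singleton (x y : Name) : valOf [y] x = [(([] : Name), y)].lookup x := by
  rcases x with _ | ⟨b, x⟩
  · simp [valOf]
  · simp [valOf, List.lookup]

/-- Binding the first unused variable number appends a value to the list. Thus a list of values can
stand for the valuation throughout. -/
theorem update_valOf (l : List Name) (d : Name) :
    Function.update (valOf l) (unary l.length) (some d) = valOf (l ++ [d]) := by
  funext x
  by_cases h : x = unary l.length
  · subst h
    rw [Function.update_self, valOf_unary]
    simp
  · rw [Function.update_of_ne h]
    unfold valOf
    split_ifs with hx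
    · have hne : x.length ≠ l.length := fun h' => h (by rw [hx, h'])
      by_cases hlt : x.length < l.length
      · rw [List.getElem?_append_left hlt]
      · rw [List.getElem?_eq_none (by omega), List.getElem?_eq_none (by simp; omega)]
    · rfl

theorem holds_posCond (j : ℕ) (d : Name) (l : List Name) :
    (posCond j).Holds d (valOf l) ↔ d ∈ l.take (j + 1) := by
  induction j with
  | zero => cases l <;> simp [posCond, Condition.Holds, valOf_nil, eq_comm]
  | succ j ih =>
    rw [posCond, Condition.Holds, ih, List.take_add_one (i := j + 1), Condition.Holds, valOf_unary]
    simp only [List.mem_append, Option.mem_toList, or_comm]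

/-- A data value followed by itself. -/
def doubled (ds : List Name) : DataWord A := ds.flatMap fun d => [(a, d), (a, d)]

/-- `wrap` puts its largest variable innermost, so the induction generalizes `r` and the new binder
contributes the last entry of `ds`. In its test, the equality forces the repetition of the value and
the negated `posCond j` its difference from `[]` and all earlier values. -/
theorem mem_lang_wrap (j : ℕ) (r : REWB A) (w : DataWord A) :
    w ∈ (wrap a j r).lang (valOf [[]]) ↔ ∃ ds : List Name, ds.length = j ∧
      (([] : Name) :: ds).Nodup ∧ ∃ w' ∈ r.lang (valOf ([] :: ds)), w = doubled a ds ++ w' := by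
  induction j generalizing r with
  | zero =>
    constructor
    · intro h
      exact ⟨[], rfl, by simp, w, h, rfl⟩
    · rintro ⟨ds, h, -, w', hw', rfl⟩
      obtain rfl := List.length_eq_zero_iff.1 h
      exact hw'
  | succ j ih =>
    rw [wrap, ih]
    constructor
    · rintro ⟨ds, rfl, hnd, w', ⟨d, w₁, hw₁, rfl⟩, rfl⟩
      obtain ⟨w₂, ⟨d', hd', rfl⟩, w₃, hw₃, rfl⟩ := Language.mem_mul.1 hw₁
      have hu := update_valOf ([] :: ds) d
      simp only [List.length_cons] at hu
      rw [hu] at hd' hw₃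
      simp only [Condition.Holds, holds_posCond, valOf_unary] at hd'
      obtain ⟨h1, h2⟩ := hd'
      have : d' = d := by simpa [eq_comm] using h1
      subst this
      refine ⟨ds ++ [d'], by simp, ?_, w₃, hw₃, by simp [doubled]⟩
      rw [← List.cons_append, List.nodup_append]
      refine ⟨hnd, by simp, ?_⟩
      rintro x hx y hy rfl
      obtain rfl : x = d' := by simpa using hy
      apply h2
      rw [show ([] :: ds ++ [x]).take (ds.length + 1) = [] :: ds by simp]
      exact hx
    · rintro ⟨ds, hl, hnd, w', hw', rfl⟩
      obtain ⟨ds, d, rfl⟩ : ∃ ds' d, ds = ds' ++ [d] := by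
        rcases List.eq_nil_or_concat ds with rfl | ⟨ds', d, rfl⟩
        · simp at hl
        · exact ⟨ds', d, by simp⟩
      obtain rfl : ds.length = j := by simpa using hl
      rw [← List.cons_append, List.nodup_append] at hnd
      refine ⟨ds, rfl, hnd.1, (a, d) :: ([(a, d)] ++ w'),
        ⟨d, [(a, d)] ++ w', Language.mem_mul.2 ⟨[(a, d)], ⟨d, ?_, rfl⟩, w', ?_, rfl⟩, rfl⟩,
        by simp [doubled]⟩
      · have hu := update_valOf ([] :: ds) d
        simp only [List.length_cons] at hu
        rw [hu]
        simp only [Condition.Holds, holds_posCond, valOf_unary]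
        refine ⟨by simp, fun h => ?_⟩
        rw [show ([] :: ds ++ [d]).take (ds.length + 1) = [] :: ds by simp] at h
        exact hnd.2.2 d h d (by simp) rfl
      · have hu := update_valOf ([] :: ds) d
        simp only [List.length_cons] at hu
        rw [hu]
        exact hw'

/-- The data word with the data values of a list of pairs. -/
def pairWord (qs : List (Name × Name)) : DataWord A := qs.flatMap fun q => [(a, q.1), (a, q.2)]

theorem mem_lang_starPart (ds : List Name) (w : DataWord A) :
    w ∈ (starPart a ds.length).lang (valOf ([] :: ds)) ↔
      ∃ qs : List (Name × Name), (∀ q ∈ qs, q.1 ∈ ([] : Name) :: ds ↔ q.2 = []) ∧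
        w = pairWord a qs := by
  -- A single round of the star reads exactly one pair; the two summands are the two ways in which
  -- the equivalence can hold.
  have key : ∀ u : DataWord A, u ∈ (REWB.plus (.cat (.test a (posCond ds.length)) (.test a (.eq [])))
      (.cat (.test a (.not (posCond ds.length))) (.test a (.ne [])))).lang (valOf ([] :: ds)) ↔
      ∃ q : Name × Name, (q.1 ∈ ([] : Name) :: ds ↔ q.2 = []) ∧ u = [(a, q.1), (a, q.2)] := by
    intro u
    have h1 : ([] :: ds : List Name).take (ds.length + 1) = [] :: ds := by simp
    constructor
    · rintro (h | h)
      · obtain ⟨_, ⟨d, hd, rfl⟩, _, ⟨d', hd', rfl⟩, rfl⟩ := Language.mem_mul.1 h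
        rw [holds_posCond, h1] at hd
        simp only [Condition.Holds, valOf_nil, List.head?_cons, Option.some.injEq] at hd'
        exact ⟨(d, d'), by simp only [hd, hd'.symm], rfl⟩
      · obtain ⟨_, ⟨d, hd, rfl⟩, _, ⟨d', hd', rfl⟩, rfl⟩ := Language.mem_mul.1 h
        rw [Condition.Holds, holds_posCond, h1] at hd
        simp only [Condition.Holds, valOf_nil, List.head?_cons, ne_eq, Option.some.injEq] at hd'
        exact ⟨(d, d'), by simp only [hd, Ne.symm hd'], rfl⟩
    · rintro ⟨⟨d, d'⟩, h, rfl⟩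
      by_cases hd : d ∈ ([] : Name) :: ds
      · refine Or.inl (Language.mem_mul.2 ⟨[(a, d)], ⟨d, ?_, rfl⟩, [(a, d')], ⟨d', ?_, rfl⟩, rfl⟩)
        · rw [holds_posCond, h1]; exact hd
        · simpa [Condition.Holds, valOf_nil, eq_comm] using h.1 hd
      · refine Or.inr (Language.mem_mul.2 ⟨[(a, d)], ⟨d, ?_, rfl⟩, [(a, d')], ⟨d', ?_, rfl⟩, rfl⟩)
        · rw [Condition.Holds, holds_posCond, h1]; exact hd
        · simp only [Condition.Holds, valOf_nil, List.head?_cons, ne_eq, Option.some.injEq]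
          exact fun h' => hd (h.2 h'.symm)
  rw [starPart, REWB.lang, Language.mem_kstar]
  constructor
  · rintro ⟨L, rfl, hL⟩
    induction L with
    | nil => exact ⟨[], by simp, rfl⟩
    | cons u L ih =>
      obtain ⟨qs, hqs, hw⟩ := ih fun y hy => hL y (List.mem_cons_of_mem _ hy)
      obtain ⟨q, hq, rfl⟩ := (key u).1 (hL u (by simp))
      refine ⟨q :: qs, ?_, by simp [pairWord, hw]⟩
      intro q' hq'
      rcases List.mem_cons.1 hq' with rfl | h
      exacts [hq, hqs _ h]
  · rintro ⟨qs, hqs, rfl⟩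
    refine ⟨qs.map fun q => [(a, q.1), (a, q.2)], by simp [pairWord, List.flatMap], ?_⟩
    intro y hy
    obtain ⟨q, hq, rfl⟩ := List.mem_map.1 hy
    exact (key _).2 ⟨q, hqs q hq, rfl⟩

end Query

-- The data graph as a branching program

section Graph

variable {A : Type} (a : A)

/-- The vertices where a choice among formulas is made. -/
abbrev mainVertex (i : ℕ) : Name := unary i

/-- The vertices between a data value and its marker. -/
abbrev midVertex (i : ℕ) : Name := false :: unary i

theorem mainVertex_injective : Function.Injective mainVertex := fun i j h => by
  simpa using congrArg List.length h

theorem midVertex_injective : Function.Injective midVertex := fun i j h => by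
  simpa using congrArg List.length h

theorem mainVertex_ne_midVertex (i j : ℕ) : mainVertex i ≠ midVertex j := by
  cases i <;> simp [List.replicate_succ]

/-- The edges for an atom `p` that is evaluated at the vertex `s`, with exits `t` and `f`. -/
def atomEdges (p : Name) (s t f n : ℕ) : List (Name × A × Name × Name) :=
  [(midVertex n, a, [false], mainVertex f), (midVertex n, a, [], mainVertex t),
    (mainVertex s, a, true :: p, midVertex n), (midVertex 0, a, true :: p, mainVertex 0),
    (mainVertex 0, a, true :: p, midVertex 0)]

/-- The edges for a formula that is evaluated at the vertex `s`, with exits `t` and `f` for the two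
truth values, and the first unused vertex; `n` was the first unused vertex before. -/
def formulaEdges : BoolFormula → ℕ → ℕ → ℕ → ℕ → List (Name × A × Name × Name) × ℕ
  | .atom p, s, t, f, n => (atomEdges a p s t f n, n + 1)
  | .neg φ, s, t, f, n => formulaEdges φ s f t n
  | .conj φ ψ, s, t, f, n =>
    ((formulaEdges ψ n t f (formulaEdges φ s n f (n + 1)).2).1 ++
      (formulaEdges φ s n f (n + 1)).1, (formulaEdges ψ n t f (formulaEdges φ s n f (n + 1)).2).2)
  | .disj φ ψ, s, t, f, n =>
    ((formulaEdges ψ n t f (formulaEdges φ s t n (n + 1)).2).1 ++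
      (formulaEdges φ s t n (n + 1)).1, (formulaEdges ψ n t f (formulaEdges φ s t n (n + 1)).2).2)

theorem lt_formulaEdges_snd (φ : BoolFormula) (s t f n : ℕ) :
    n < (formulaEdges a φ s t f n).2 := by
  induction φ generalizing s t f n with
  | atom p => simp [formulaEdges]
  | neg φ ih => exact ih _ _ _ _
  | conj φ ψ h₁ h₂ => exact (Nat.lt_succ_self n).trans ((h₁ _ _ _ _).trans (h₂ _ _ _ _))
  | disj φ ψ h₁ h₂ => exact (Nat.lt_succ_self n).trans ((h₁ _ _ _ _).trans (h₂ _ _ _ _))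

/-- The possible edges of the graph of a formula. -/
inductive IsEdge (P : Name → Prop) (n : ℕ) : Name × A × Name × Name → Prop
  | enter (p i j) : P p → i < n → j < n → IsEdge P n (mainVertex i, a, true :: p, midVertex j)
  | back (p) : P p → 0 < n → IsEdge P n (midVertex 0, a, true :: p, mainVertex 0)
  | leave (b : Bool) (i j) : i < n → j < n →
      IsEdge P n (midVertex i, a, bif b then [] else [false], mainVertex j)

theorem IsEdge.mono {P Q : Name → Prop} {n m : ℕ} {e} (h : IsEdge a P n e)
    (hPQ : ∀ p, P p → Q p) (hnm : n ≤ m) : IsEdge a Q m e := by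
  cases h with
  | enter p i j hp hi hj => exact .enter p i j (hPQ p hp) (hi.trans_le hnm) (hj.trans_le hnm)
  | back p hp hn => exact .back p (hPQ p hp) (hn.trans_le hnm)
  | leave b i j hi hj => exact .leave b i j (hi.trans_le hnm) (hj.trans_le hnm)

/-- All vertex numbers stay below the counter. Vertices allocated later are therefore untouched by
these edges, and the labels are restricted to the three shapes of `IsEdge`. -/
theorem isEdge_formulaEdges (φ : BoolFormula) (s t f n : ℕ) (hs : s < n) (ht : t < n)
    (hf : f < n) {e} (he : e ∈ (formulaEdges a φ s t f n).1) :
    IsEdge a (· ∈ φ.atoms) (formulaEdges a φ s t f n).2 e := by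
  induction φ generalizing s t f n with
  | atom p =>
    simp only [formulaEdges, atomEdges, List.mem_cons, List.not_mem_nil, or_false] at he ⊢
    have hp : p ∈ (BoolFormula.atom p).atoms := by simp [BoolFormula.atoms]
    rcases he with rfl | rfl | rfl | rfl | rfl
    · exact .leave false _ _ (by omega) (by omega)
    · exact .leave true _ _ (by omega) (by omega)
    · exact .enter _ _ _ hp (by omega) (by omega)
    · exact .back _ hp (by omega)
    · exact .enter _ _ _ hp (by omega) (by omega)
  | neg φ ih => exact ih _ _ _ _ hs hf ht he
  | conj φ ψ h₁ h₂ =>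
    have hl := lt_formulaEdges_snd a φ s n f (n + 1)
    rcases List.mem_append.1 he with he | he
    · exact (h₂ _ _ _ _ (by omega) (by omega) (by omega) he).mono a
        (fun p hp => Finset.mem_union_right _ hp) le_rfl
    · exact (h₁ _ _ _ _ (by omega) (by omega) (by omega) he).mono a
        (fun p hp => Finset.mem_union_left _ hp) (lt_formulaEdges_snd a ψ _ _ _ _).le
  | disj φ ψ h₁ h₂ =>
    have hl := lt_formulaEdges_snd a φ s t n (n + 1)
    rcases List.mem_append.1 he with he | he
    · exact (h₂ _ _ _ _ (by omega) (by omega) (by omega) he).mono a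
        (fun p hp => Finset.mem_union_right _ hp) le_rfl
    · exact (h₁ _ _ _ _ (by omega) (by omega) (by omega) he).mono a
        (fun p hp => Finset.mem_union_left _ hp) (lt_formulaEdges_snd a ψ _ _ _ _).le

/-- A set `I` of main vertices together with sets `J true`, `J false` of mid vertices (reached after
a data value inside or outside of `l`) is closed under walking along the edge `e`. -/
def EdgeClosed (l : List Name) (I : ℕ → Prop) (J : Prop → ℕ → Prop)
    (e : Name × A × Name × Name) : Prop :=
  (∀ i, e.1 = mainVertex i → I i → ∃ j, e.2.2.2 = midVertex j ∧ J (e.2.2.1 ∈ l) j) ∧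
  (∀ i, e.1 = midVertex i → J (e.2.2.1 = []) i → ∃ j, e.2.2.2 = mainVertex j ∧ I j)

/-- Closedness under an edge only involves its endpoints, which are numbered below `n`. The sets may
thus be changed on fresh vertices when the next subformula is treated. -/
theorem EdgeClosed.congr {l : List Name} {I I' : ℕ → Prop} {J J' : Prop → ℕ → Prop} {P n}
    {e : Name × A × Name × Name} (he : IsEdge a P n e) (hI : ∀ i < n, I' i = I i)
    (hJ : ∀ c, ∀ i < n, J' c i = J c i) (h : EdgeClosed l I J e) : EdgeClosed l I' J' e := by
  cases he with
  | enter p i j hp hi hj =>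
    refine ⟨fun i' hi' hI' => ?_, fun i' hi' => absurd hi' (mainVertex_ne_midVertex _ _)⟩
    obtain rfl := mainVertex_injective hi'
    rw [hI _ hi] at hI'
    obtain ⟨j', hj', hJ'⟩ := h.1 i rfl hI'
    obtain rfl := midVertex_injective hj'
    exact ⟨j, rfl, by rw [hJ _ _ hj]; exact hJ'⟩
  | back p hp hn =>
    refine ⟨fun i' hi' => absurd hi'.symm (mainVertex_ne_midVertex _ _), fun i' hi' hJ' => ?_⟩
    obtain rfl := midVertex_injective hi'
    rw [hJ _ _ hn] at hJ'
    obtain ⟨j', hj', hI'⟩ := h.2 0 rfl hJ'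
    obtain rfl := mainVertex_injective hj'
    exact ⟨0, rfl, by rw [hI _ hn]; exact hI'⟩
  | leave b i j hi hj =>
    refine ⟨fun i' hi' => absurd hi'.symm (mainVertex_ne_midVertex _ _), fun i' hi' hJ' => ?_⟩
    obtain rfl := midVertex_injective hi'
    rw [hJ _ _ hi] at hJ'
    obtain ⟨j', hj', hI'⟩ := h.2 i rfl hJ'
    obtain rfl := mainVertex_injective hj'
    exact ⟨j, rfl, by rw [hI _ hj]; exact hI'⟩

/-- Soundness of the graph: walks that read only correct pairs cannot take a wrong exit. The sets
`I`, `J` over-approximate what such walks reach; if they respect the two exits of the subformula,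
they extend to its fresh vertices so as to be closed under its edges. `J` depends on a proposition,
which records whether the value read on the way to the mid vertex lies in `l`. -/
theorem exists_edgeClosed (l : List Name) (S : Finset Name) (φ : BoolFormula)
    (hS : ∀ p ∈ φ.atoms, p ∈ S ↔ true :: p ∈ l) (s t f n : ℕ) (hs : s < n) (ht : t < n)
    (hf : f < n) (I : ℕ → Prop) (J : Prop → ℕ → Prop) (hI : I 0) (hJ : ∀ c, J c 0)
    (hIt : I s → φ.Sat S → I t) (hIf : I s → ¬ φ.Sat S → I f) :
    ∃ I' J', (∀ i < n, I' i = I i) ∧ (∀ c, ∀ i < n, J' c i = J c i) ∧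
      ∀ e ∈ (formulaEdges a φ s t f n).1, EdgeClosed l I' J' e := by
  induction φ generalizing s t f n I J with
  | atom p =>
    have hp := hS p (by simp [BoolFormula.atoms])
    -- The new mid vertex is entered only from `s` and with the value `true :: p`, so its flag `c`
    -- has to be the truth value of `p`.
    refine ⟨I, fun c i => if i = n then I s ∧ (c ↔ true :: p ∈ l) else J c i, fun _ _ => rfl,
      fun c i hi => if_neg hi.ne, ?_⟩
    have hn0 : 0 ≠ n := by omega
    intro e he
    simp only [formulaEdges, atomEdges, List.mem_cons, List.not_mem_nil, or_false] at he
    simp only [BoolFormula.Sat] at hIt hIf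
    rcases he with rfl | rfl | rfl | rfl | rfl
    · refine ⟨fun i' hi' => absurd hi'.symm (mainVertex_ne_midVertex _ _), fun i' hi' hJ' => ?_⟩
      obtain rfl := midVertex_injective hi'
      simp only [if_pos, List.cons_ne_nil, false_iff] at hJ'
      exact ⟨f, rfl, hIf hJ'.1 (fun h => hJ'.2 (hp.1 h))⟩
    · refine ⟨fun i' hi' => absurd hi'.symm (mainVertex_ne_midVertex _ _), fun i' hi' hJ' => ?_⟩
      obtain rfl := midVertex_injective hi'
      simp only [if_pos, true_iff] at hJ'
      exact ⟨t, rfl, hIt hJ'.1 (hp.2 hJ'.2)⟩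
    · refine ⟨fun i' hi' hI' => ?_, fun i' hi' => absurd hi' (mainVertex_ne_midVertex _ _)⟩
      obtain rfl := mainVertex_injective hi'
      exact ⟨n, rfl, by simpa using hI'⟩
    · refine ⟨fun i' hi' => absurd hi'.symm (mainVertex_ne_midVertex _ _), fun i' hi' hJ' => ?_⟩
      exact ⟨0, rfl, hI⟩
    · refine ⟨fun i' hi' hI' => ?_, fun i' hi' => absurd hi' (mainVertex_ne_midVertex _ _)⟩
      exact ⟨0, rfl, by simpa [hn0] using hJ _⟩
  | neg φ ih =>
    exact ih hS _ _ _ _ hs hf ht I J hI hJ (fun h h' => hIf h (fun h'' => h'' h'))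
      (fun h h' => hIt h h')
  | conj φ ψ h₁ h₂ =>
    have hl := lt_formulaEdges_snd a φ s n f (n + 1)
    -- The fresh vertex `n`, where the second conjunct is evaluated, is admitted only if `s` is and
    -- the first conjunct is true.
    obtain ⟨I₂, J₂, hI₂, hJ₂, hc₂⟩ := h₁ (fun p hp => hS p (Finset.mem_union_left _ hp)) s n f
      (n + 1) (by omega) (by omega) (by omega) (fun i => if i = n then I s ∧ φ.Sat S else I i) J
      (by rw [if_neg (by omega)]; exact hI) hJ
      (by simp only [hs.ne, if_true, if_false]; exact fun h h' => ⟨h, h'⟩)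
      (by
        simp only [hs.ne, hf.ne, if_false]
        exact fun h h' => hIf h (fun h'' => h' h''.1))
    obtain ⟨I₃, J₃, hI₃, hJ₃, hc₃⟩ := h₂ (fun p hp => hS p (Finset.mem_union_right _ hp)) n t f
      _ hl.le (by omega) (by omega) I₂ J₂ (by rw [hI₂ _ (by omega), if_neg (by omega)]; exact hI)
      (fun c => by rw [hJ₂ _ _ (by omega)]; exact hJ c)
      (by
        rw [hI₂ n (by omega), hI₂ t (by omega), if_pos rfl, if_neg ht.ne]
        exact fun h h' => hIt h.1 ⟨h.2, h'⟩)
      (by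
        rw [hI₂ n (by omega), hI₂ f (by omega), if_pos rfl, if_neg hf.ne]
        exact fun h h' => hIf h.1 (fun h'' => h' h''.2))
    refine ⟨I₃, J₃, fun i hi => ?_, fun c i hi => ?_, fun e he => ?_⟩
    · rw [hI₃ i (by omega), hI₂ i (by omega), if_neg hi.ne]
    · rw [hJ₃ c i (by omega), hJ₂ c i (by omega)]
    · rcases List.mem_append.1 he with he | he
      · exact hc₃ e he
      · exact (hc₂ e he).congr a (isEdge_formulaEdges a φ _ _ _ _ (by omega) (by omega) (by omega) he)
          hI₃ hJ₃
  | disj φ ψ h₁ h₂ =>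
    have hl := lt_formulaEdges_snd a φ s t n (n + 1)
    -- Dually, the second disjunct is evaluated at `n` only after the first one was found false.
    obtain ⟨I₂, J₂, hI₂, hJ₂, hc₂⟩ := h₁ (fun p hp => hS p (Finset.mem_union_left _ hp)) s t n
      (n + 1) (by omega) (by omega) (by omega) (fun i => if i = n then I s ∧ ¬ φ.Sat S else I i) J
      (by rw [if_neg (by omega)]; exact hI) hJ
      (by
        simp only [hs.ne, ht.ne, if_false]
        exact fun h h' => hIt h (Or.inl h'))
      (by simp only [hs.ne, if_true, if_false]; exact fun h h' => ⟨h, h'⟩)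
    obtain ⟨I₃, J₃, hI₃, hJ₃, hc₃⟩ := h₂ (fun p hp => hS p (Finset.mem_union_right _ hp)) n t f
      _ hl.le (by omega) (by omega) I₂ J₂ (by rw [hI₂ _ (by omega), if_neg (by omega)]; exact hI)
      (fun c => by rw [hJ₂ _ _ (by omega)]; exact hJ c)
      (by
        rw [hI₂ n (by omega), hI₂ t (by omega), if_pos rfl, if_neg ht.ne]
        exact fun h h' => hIt h.1 (Or.inr h'))
      (by
        rw [hI₂ n (by omega), hI₂ f (by omega), if_pos rfl, if_neg hf.ne]
        exact fun h h' => hIf h.1 (fun h'' => h''.elim h.2 h'))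
    refine ⟨I₃, J₃, fun i hi => ?_, fun c i hi => ?_, fun e he => ?_⟩
    · rw [hI₃ i (by omega), hI₂ i (by omega), if_neg hi.ne]
    · rw [hJ₃ c i (by omega), hJ₂ c i (by omega)]
    · rcases List.mem_append.1 he with he | he
      · exact hc₃ e he
      · exact (hc₂ e he).congr a (isEdge_formulaEdges a φ _ _ _ _ (by omega) (by omega) (by omega) he)
          hI₃ hJ₃

theorem DataGraph.DataPath.append {G : DataGraph A} {u v t : Name} {w w' : DataWord A}
    (h : G.DataPath u w v) (h' : G.DataPath v w' t) : G.DataPath u (w ++ w') t := by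
  induction h with
  | nil _ => exact h'
  | cons he _ ih => exact .cons he (ih h')

/-- Completeness of the graph: short-circuit evaluation of the formula yields a walk to the correct
exit that answers every atom truthfully. Both exits are needed together, since negation exchanges
them. -/
theorem exists_dataPath {G : DataGraph A} (l : List Name) (S : Finset Name) (φ : BoolFormula)
    (hS : ∀ p ∈ φ.atoms, p ∈ S ↔ true :: p ∈ l) (s t f n : ℕ)
    (hG : ∀ e ∈ (formulaEdges a φ s t f n).1, e ∈ G.E) :
    (φ.Sat S → ∃ qs : List (Name × Name), (∀ q ∈ qs, q.1 ∈ l ↔ q.2 = []) ∧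
      G.DataPath (mainVertex s) (pairWord a qs) (mainVertex t)) ∧
    (¬ φ.Sat S → ∃ qs : List (Name × Name), (∀ q ∈ qs, q.1 ∈ l ↔ q.2 = []) ∧
      G.DataPath (mainVertex s) (pairWord a qs) (mainVertex f)) := by
  have append : ∀ {u v w : Name}, (∃ qs : List (Name × Name), (∀ q ∈ qs, q.1 ∈ l ↔ q.2 = []) ∧
      G.DataPath u (pairWord a qs) v) → (∃ qs : List (Name × Name),
      (∀ q ∈ qs, q.1 ∈ l ↔ q.2 = []) ∧ G.DataPath v (pairWord a qs) w) →
      ∃ qs : List (Name × Name), (∀ q ∈ qs, q.1 ∈ l ↔ q.2 = []) ∧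
        G.DataPath u (pairWord a qs) w := by
    rintro u v w ⟨qs, h, h'⟩ ⟨qs', g, g'⟩
    refine ⟨qs ++ qs', fun q hq => ?_, ?_⟩
    · rcases List.mem_append.1 hq with hq | hq
      exacts [h q hq, g q hq]
    · have := h'.append g'
      simpa [pairWord] using this
  induction φ generalizing s t f n with
  | atom p =>
    have hp := hS p (by simp [BoolFormula.atoms])
    simp only [formulaEdges, atomEdges, List.mem_cons, List.not_mem_nil, or_false] at hG
    have h1 := hG _ (Or.inl rfl)
    have h2 := hG _ (Or.inr (Or.inl rfl))
    have h3 := hG _ (Or.inr (Or.inr (Or.inl rfl)))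
    constructor
    · intro h
      exact ⟨[(true :: p, [])], by simpa using hp.1 h, .cons h3 (.cons h2 (.nil (G.tgt_mem h2)))⟩
    · intro h
      refine ⟨[(true :: p, [false])], ?_, .cons h3 (.cons h1 (.nil (G.tgt_mem h1)))⟩
      simpa using fun h' => h (hp.2 h')
  | neg φ ih =>
    obtain ⟨h1, h2⟩ := ih hS s f t n hG
    exact ⟨fun h => h2 h, fun h => h1 (not_not.1 h)⟩
  | conj φ ψ ih₁ ih₂ =>
    obtain ⟨h1, h2⟩ := ih₁ (fun p hp => hS p (Finset.mem_union_left _ hp)) s n f (n + 1)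
      (fun e he => hG e (List.mem_append_right _ he))
    obtain ⟨h3, h4⟩ := ih₂ (fun p hp => hS p (Finset.mem_union_right _ hp)) n t f _
      (fun e he => hG e (List.mem_append_left _ he))
    refine ⟨fun h => append (h1 h.1) (h3 h.2), fun h => ?_⟩
    by_cases hφ : φ.Sat S
    · exact append (h1 hφ) (h4 fun hψ => h ⟨hφ, hψ⟩)
    · exact h2 hφ
  | disj φ ψ ih₁ ih₂ =>
    obtain ⟨h1, h2⟩ := ih₁ (fun p hp => hS p (Finset.mem_union_left _ hp)) s t n (n + 1)
      (fun e he => hG e (List.mem_append_right _ he))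
    obtain ⟨h3, h4⟩ := ih₂ (fun p hp => hS p (Finset.mem_union_right _ hp)) n t f _
      (fun e he => hG e (List.mem_append_left _ he))
    refine ⟨fun h => ?_, fun h => append (h2 fun h' => h (Or.inl h')) (h4 fun h' => h (Or.inr h'))⟩
    by_cases hφ : φ.Sat S
    · exact h1 hφ
    · exact append (h2 hφ) (h3 (h.resolve_left hφ))

/-- A list of the vertices with indices below `n`. -/
def vertexList (n : ℕ) : List Name :=
  (List.range n).flatMap fun i => [mainVertex i, midVertex i]

theorem mem_vertexList {n : ℕ} {v : Name} :
    v ∈ vertexList n ↔ ∃ i < n, v = mainVertex i ∨ v = midVertex i := by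
  simp [vertexList]

variable {a} in
theorem IsEdge.mem_vertexList {P n} {e : Name × A × Name × Name} (h : IsEdge a P n e) :
    e.1 ∈ vertexList n ∧ e.2.2.2 ∈ vertexList n := by
  simp only [_root_.mem_vertexList]
  cases h with
  | enter p i j hp hi hj => exact ⟨⟨i, hi, Or.inl rfl⟩, ⟨j, hj, Or.inr rfl⟩⟩
  | back p hp hn => exact ⟨⟨0, hn, Or.inr rfl⟩, ⟨0, hn, Or.inl rfl⟩⟩
  | leave b i j hi hj => exact ⟨⟨i, hi, Or.inr rfl⟩, ⟨j, hj, Or.inl rfl⟩⟩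

open Classical in
/-- The data graph of a formula. -/
noncomputable def formulaGraph (φ : BoolFormula) : DataGraph A where
  V := (vertexList (formulaEdges a φ 0 1 2 3).2).toFinset
  E := (formulaEdges a φ 0 1 2 3).1.toFinset
  src_mem h := List.mem_toFinset.2 (isEdge_formulaEdges a φ 0 1 2 3 (by omega) (by omega) (by omega)
    (List.mem_toFinset.1 h)).mem_vertexList.1
  tgt_mem h := List.mem_toFinset.2 (isEdge_formulaEdges a φ 0 1 2 3 (by omega) (by omega) (by omega)
    (List.mem_toFinset.1 h)).mem_vertexList.2

theorem mem_formulaGraph_E {φ : BoolFormula} {e : Name × A × Name × Name} :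
    e ∈ (formulaGraph a φ).E ↔ e ∈ (formulaEdges a φ 0 1 2 3).1 := by
  classical exact List.mem_toFinset

/-- The instance of the query evaluation problem for a formula and a number. -/
noncomputable def formulaInstance (φ : BoolFormula) (k : ℕ) : QueryInstance A where
  graph := formulaGraph a φ
  expr := query a k
  val := valOf [[]]
  source := mainVertex 0
  target := mainVertex 1
  compatible x hx := by
    rw [fv_query a k x hx, valOf_nil]
    rfl
  source_mem := List.mem_toFinset.2 (mem_vertexList.2
    ⟨0, by have := lt_formulaEdges_snd a φ 0 1 2 3; omega, Or.inl rfl⟩)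
  target_mem := List.mem_toFinset.2 (mem_vertexList.2
    ⟨1, by have := lt_formulaEdges_snd a φ 0 1 2 3; omega, Or.inl rfl⟩)

variable {a} in
-- The first edge out of vertex 0 has a label `true :: p`. The second one repeats it and leaves a
-- mid vertex, but the edges to the exits are labeled `[]` or `[false]`; only the edge back to
-- vertex 0 remains.
theorem dataPath_doubled {φ : BoolFormula} {ds : List Name} {w : DataWord A} {v : Name}
    (h : (formulaGraph a φ).DataPath (mainVertex 0) (doubled a ds ++ w) v) :
    (∀ d ∈ ds, ∃ p ∈ φ.atoms, d = true :: p) ∧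
      (formulaGraph a φ).DataPath (mainVertex 0) w v := by
  have edge : ∀ {e}, e ∈ (formulaGraph a φ).E →
      IsEdge a (· ∈ φ.atoms) (formulaEdges a φ 0 1 2 3).2 e := fun he =>
    isEdge_formulaEdges a φ 0 1 2 3 (by omega) (by omega) (by omega) ((mem_formulaGraph_E a).1 he)
  induction ds with
  | nil => exact ⟨by simp, h⟩
  | cons d ds ih =>
    rw [show doubled a (d :: ds) ++ w = (a, d) :: (a, d) :: (doubled a ds ++ w) by
      simp [doubled]] at h
    generalize hu : mainVertex 0 = u at h
    obtain _ | ⟨he, _ | ⟨he', h⟩⟩ := h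
    have h1 := edge he
    have h2 := edge he'
    generalize hx : (u, a, d, _) = x at h1
    generalize hy : (_, a, d, _) = y at h2
    cases h1 with
    | enter p i j hp hi hj =>
      simp only [Prod.mk.injEq, true_and] at hx
      obtain ⟨-, rfl, rfl⟩ := hx
      cases h2 with
      | enter p' i' j' _ _ _ =>
        simp only [Prod.mk.injEq] at hy
        exact absurd hy.1.symm (mainVertex_ne_midVertex _ _)
      | back p' hp' _ =>
        simp only [Prod.mk.injEq] at hy
        obtain ⟨-, -, -, rfl⟩ := hy
        subst hu
        obtain ⟨h3, h4⟩ := ih h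
        refine ⟨?_, h4⟩
        intro d hd
        rcases List.mem_cons.1 hd with rfl | hd
        · exact ⟨p, hp, rfl⟩
        · exact h3 d hd
      | leave b i' j' _ _ => cases b <;> simp at hy
    | back p hp _ =>
      simp only [Prod.mk.injEq] at hx
      exact absurd (hu.trans hx.1) (mainVertex_ne_midVertex _ _)
    | leave b i j _ _ =>
      simp only [Prod.mk.injEq] at hx
      exact absurd (hu.trans hx.1) (mainVertex_ne_midVertex _ _)

/-- The selected values have the form `true :: p` and are pairwise distinct, so stripping the
leading `true` gives a set of exactly `k` atoms, and conversely. The second part of the word then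
evaluates the formula under this assignment. -/
theorem isYes_formulaInstance (φ : BoolFormula) (k : ℕ) :
    (formulaInstance a φ k).IsYes ↔ ∃ S ⊆ φ.atoms, S.card = k ∧ φ.Sat S := by
  have hw : ∀ w, w ∈ (formulaInstance a φ k).expr.lang (formulaInstance a φ k).val ↔ _ :=
    fun w => mem_lang_wrap a k (starPart a k) w
  constructor
  · rintro ⟨w, hwl, hpath₀⟩
    obtain ⟨ds, rfl, hnd, w', hw', rfl⟩ := (hw w).1 hwl
    obtain ⟨qs, hqs, rfl⟩ := (mem_lang_starPart a ds w').1 hw'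
    obtain ⟨hds, hpath⟩ := dataPath_doubled hpath₀
    refine ⟨(ds.map List.tail).toFinset, ?_, ?_, ?_⟩
    · intro x hx
      obtain ⟨d, hd, rfl⟩ := List.mem_map.1 (List.mem_toFinset.1 hx)
      obtain ⟨p, hp, rfl⟩ := hds d hd
      exact hp
    · rw [List.toFinset_card_of_nodup, List.length_map]
      refine List.Nodup.map_on ?_ (List.nodup_cons.1 hnd).2
      intro x hx y hy hxy
      obtain ⟨p, -, rfl⟩ := hds x hx
      obtain ⟨q, -, rfl⟩ := hds y hy
      exact congrArg _ hxy
    · set S := (ds.map List.tail).toFinset with hSdef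
      by_contra hsat
      have hS : ∀ p ∈ φ.atoms, p ∈ S ↔ true :: p ∈ ([] : Name) :: ds := by
        intro p _
        simp only [hSdef, List.mem_toFinset, List.mem_map, List.mem_cons, List.cons_ne_nil,
          false_or]
        constructor
        · rintro ⟨d, hd, rfl⟩
          obtain ⟨q, -, rfl⟩ := hds d hd
          exact hd
        · exact fun h => ⟨_, h, rfl⟩
      -- Of the three initial vertices only the exit 1 is excluded. If the assignment falsified the
      -- formula, this would extend to a closed invariant, and the exit 1 would be unreachable from
      -- 0.
      obtain ⟨I, J, hI, hJ, hc⟩ := exists_edgeClosed a _ S φ hS 0 1 2 3 (by omega) (by omega)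
        (by omega) (fun i => i ≠ 1) (fun _ _ => True) (by simp) (by simp) (fun _ h => absurd h hsat)
        (fun _ _ => by simp)
      have key : ∀ i, I i → ¬ (formulaGraph a φ).DataPath (mainVertex i) (pairWord a qs)
          (mainVertex 1) := by
        clear hpath hpath₀ hw' hwl
        induction qs with
        | nil =>
          intro i hi h
          generalize hu : mainVertex i = u at h
          generalize hv : mainVertex 1 = v at h
          cases h
          obtain rfl := mainVertex_injective (hu.trans hv.symm)
          rw [hI 1 (by omega)] at hi
          exact hi rfl
        | cons q qs ih =>
          intro i hi h
          rw [show pairWord a (q :: qs) = (a, q.1) :: (a, q.2) :: pairWord a qs by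
            simp [pairWord]] at h
          obtain _ | ⟨he, _ | ⟨he', h⟩⟩ := h
          obtain ⟨j, hj, hJj⟩ := (hc _ ((mem_formulaGraph_E a).1 he)).1 i rfl hi
          -- The star equates membership of the value with the marker being `[]`, so the flag set by
          -- the first edge is the one that the second edge consults.
          rw [propext (hqs q (by simp))] at hJj
          obtain ⟨i', hi', hIi⟩ := (hc _ ((mem_formulaGraph_E a).1 he')).2 j hj hJj
          dsimp only at hi'
          subst hi'
          exact ih (fun q hq => hqs q (List.mem_cons_of_mem _ hq)) i' hIi h
      refine key 0 ?_ hpath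
      rw [hI 0 (by omega)]
      simp
  · rintro ⟨S, hSa, rfl, hsat⟩
    set ds := S.toList.map (fun p => true :: p) with hds
    have hlen : ds.length = S.card := by simp [hds]
    have hS : ∀ p ∈ φ.atoms, p ∈ S ↔ true :: p ∈ ([] : Name) :: ds := by simp [hds]
    obtain ⟨qs, hqs, hpath⟩ := (exists_dataPath (G := formulaGraph a φ) a ([] :: ds) S φ hS 0 1 2 3
      (fun e he => (mem_formulaGraph_E a).2 he)).1 hsat
    refine ⟨doubled a ds ++ pairWord a qs, (hw _).2 ⟨ds, hlen, ?_, pairWord a qs, ?_, rfl⟩, ?_⟩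
    · rw [List.nodup_cons]
      refine ⟨by simp [hds], ?_⟩
      exact (Finset.nodup_toList S).map (fun x y h => (List.cons.inj h).2)
    · rw [← hlen]
      exact (mem_lang_starPart a ds _).2 ⟨qs, hqs, rfl⟩
    · have hloop : ∀ p ∈ φ.atoms, (mainVertex 0, a, true :: p, midVertex 0) ∈ (formulaGraph a φ).E ∧
          (midVertex 0, a, true :: p, mainVertex 0) ∈ (formulaGraph a φ).E := by
        -- Every occurrence of an atom also emits the selection cycle for it at vertex 0;
        -- repetitions vanish in the edge set.
        have aux : ∀ (ψ : BoolFormula) (s t f n : ℕ), ∀ p ∈ ψ.atoms,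
            (mainVertex 0, a, true :: p, midVertex 0) ∈ (formulaEdges a ψ s t f n).1 ∧
              (midVertex 0, a, true :: p, mainVertex 0) ∈ (formulaEdges a ψ s t f n).1 := by
          intro ψ
          induction ψ with
          | atom q =>
            intro s t f n p hp
            obtain rfl : p = q := by simpa [BoolFormula.atoms] using hp
            simp [formulaEdges, atomEdges]
          | neg ψ ih => exact fun s t f n => ih s f t n
          | conj ψ χ h₁ h₂ =>
            intro s t f n p hp
            simp only [formulaEdges, List.mem_append]
            rcases Finset.mem_union.1 hp with hp | hp
            · exact ⟨Or.inr (h₁ _ _ _ _ p hp).1, Or.inr (h₁ _ _ _ _ p hp).2⟩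
            · exact ⟨Or.inl (h₂ _ _ _ _ p hp).1, Or.inl (h₂ _ _ _ _ p hp).2⟩
          | disj ψ χ h₁ h₂ =>
            intro s t f n p hp
            simp only [formulaEdges, List.mem_append]
            rcases Finset.mem_union.1 hp with hp | hp
            · exact ⟨Or.inr (h₁ _ _ _ _ p hp).1, Or.inr (h₁ _ _ _ _ p hp).2⟩
            · exact ⟨Or.inl (h₂ _ _ _ _ p hp).1, Or.inl (h₂ _ _ _ _ p hp).2⟩
        intro p hp
        exact ⟨(mem_formulaGraph_E a).2 (aux φ 0 1 2 3 p hp).1,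
          (mem_formulaGraph_E a).2 (aux φ 0 1 2 3 p hp).2⟩
      have hsel : ∀ l : List Name, (∀ d ∈ l, ∃ p ∈ φ.atoms, d = true :: p) →
          (formulaGraph a φ).DataPath (mainVertex 0) (doubled a l) (mainVertex 0) := by
        intro l hl
        induction l with
        | nil => exact .nil (formulaInstance a φ 0).source_mem
        | cons d l ih =>
          obtain ⟨p, hp, rfl⟩ := hl d (by simp)
          exact .cons (hloop p hp).1 (.cons (hloop p hp).2
            (ih fun d hd => hl d (List.mem_cons_of_mem _ hd)))
      refine (hsel ds ?_).append hpath
      intro d hd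
      obtain ⟨p, hp, rfl⟩ := List.mem_map.1 hd
      exact ⟨p, hSa (Finset.mem_toList.1 hp), rfl⟩

end Graph

/-! ### Unique decoding -/

/-- Different objects have encodings that are not prefixes of each other. -/
def IsPrefixCode {α β : Type} (enc : α → List β) : Prop :=
  ∀ ⦃x y : α⦄ ⦃r s : List β⦄, enc x ++ r = enc y ++ s → x = y ∧ r = s

section Decode

variable {A : Type}

theorem isPrefixCode_encodeName : IsPrefixCode (encodeName (A := A)) := by
  intro x
  induction x with
  | nil =>
    intro y r s h
    cases y with
    | nil => exact ⟨rfl, by simpa [encodeName] using h⟩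
    | cons b y => simp [encodeName] at h
  | cons b x ih =>
    intro y r s h
    cases y with
    | nil => simp [encodeName] at h
    | cons b' y =>
      simp only [encodeName, List.map_cons, List.cons_append, List.cons.injEq,
        QuerySymbol.bit.injEq] at h
      obtain ⟨h1, h2⟩ := ih h.2
      exact ⟨by rw [h.1, h1], h2⟩

theorem IsPrefixCode.encodeList {α : Type} {enc : α → List (QuerySymbol A)}
    (h : IsPrefixCode enc) : IsPrefixCode (encodeList enc) := by
  intro x
  induction x with
  | nil =>
    intro y r s e
    cases y with
    | nil => exact ⟨rfl, by simpa [_root_.encodeList] using e⟩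
    | cons b y => simp [_root_.encodeList] at e
  | cons b x ih =>
    intro y r s e
    cases y with
    | nil => simp [_root_.encodeList] at e
    | cons b' y =>
      simp only [_root_.encodeList, List.flatMap_cons, List.cons_append, List.append_assoc,
        List.cons.injEq, true_and] at e
      obtain ⟨rfl, e1⟩ := h e
      obtain ⟨rfl, e2⟩ := ih (r := r) (s := s) (by simpa [_root_.encodeList] using e1)
      exact ⟨rfl, e2⟩

theorem isPrefixCode_encodeEdge : IsPrefixCode (encodeEdge (A := A)) := by
  rintro ⟨u, b, d, v⟩ ⟨u', b', d', v'⟩ r s e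
  simp only [encodeEdge, List.append_assoc, List.cons_append] at e
  obtain ⟨rfl, e1⟩ := isPrefixCode_encodeName e
  simp only [List.cons.injEq, QuerySymbol.letter.injEq] at e1
  obtain ⟨rfl, e2⟩ := e1
  obtain ⟨rfl, e3⟩ := isPrefixCode_encodeName e2
  obtain ⟨rfl, e4⟩ := isPrefixCode_encodeName e3
  exact ⟨rfl, e4⟩

theorem isPrefixCode_encodeBinding : IsPrefixCode (encodeBinding (A := A)) := by
  rintro ⟨u, v⟩ ⟨u', v'⟩ r s e
  simp only [encodeBinding, List.append_assoc] at e
  obtain ⟨rfl, e1⟩ := isPrefixCode_encodeName e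
  obtain ⟨rfl, e2⟩ := isPrefixCode_encodeName e1
  exact ⟨rfl, e2⟩

theorem isPrefixCode_encodeCondition : IsPrefixCode (Condition.encode (A := A)) := by
  intro x
  induction x with
  | eq x | ne x =>
    intro y r s e
    cases y <;> simp only [Condition.encode, List.cons_append, List.cons.injEq, reduceCtorEq,
      false_and, true_and] at e
    obtain ⟨rfl, e1⟩ := isPrefixCode_encodeName e
    exact ⟨rfl, e1⟩
  | not x ih =>
    intro y r s e
    cases y <;> simp only [Condition.encode, List.cons_append, List.cons.injEq, reduceCtorEq,
      false_and, true_and] at e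
    obtain ⟨rfl, e1⟩ := ih e
    exact ⟨rfl, e1⟩
  | and x x' ih ih' | or x x' ih ih' =>
    intro y r s e
    cases y <;> simp only [Condition.encode, List.cons_append, List.cons.injEq, reduceCtorEq,
      false_and, true_and, List.append_assoc] at e
    obtain ⟨rfl, e1⟩ := ih e
    obtain ⟨rfl, e2⟩ := ih' e1
    exact ⟨rfl, e2⟩

theorem isPrefixCode_encodeREWB : IsPrefixCode (REWB.encode (A := A)) := by
  intro x
  induction x with
  | eps =>
    intro y r s e
    cases y <;> simp only [REWB.encode, List.cons_append, List.cons.injEq, reduceCtorEq,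
      false_and, true_and, List.nil_append] at e
    exact ⟨rfl, e⟩
  | letter a =>
    intro y r s e
    cases y <;> simp only [REWB.encode, List.cons_append, List.cons.injEq, reduceCtorEq,
      false_and, true_and, List.nil_append, QuerySymbol.letter.injEq] at e
    exact ⟨by rw [e.1], e.2⟩
  | test a c =>
    intro y r s e
    cases y <;> simp only [REWB.encode, List.cons_append, List.cons.injEq, reduceCtorEq,
      false_and, true_and, List.nil_append, QuerySymbol.letter.injEq] at e
    obtain ⟨rfl, e1⟩ := e
    obtain ⟨rfl, e2⟩ := isPrefixCode_encodeCondition e1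
    exact ⟨rfl, e2⟩
  | plus x x' ih ih' | cat x x' ih ih' =>
    intro y r s e
    cases y <;> simp only [REWB.encode, List.cons_append, List.cons.injEq, reduceCtorEq,
      false_and, true_and, List.nil_append, List.append_assoc] at e
    obtain ⟨rfl, e1⟩ := ih e
    obtain ⟨rfl, e2⟩ := ih' e1
    exact ⟨rfl, e2⟩
  | star x ih =>
    intro y r s e
    cases y <;> simp only [REWB.encode, List.cons_append, List.cons.injEq, reduceCtorEq,
      false_and, true_and, List.nil_append] at e
    obtain ⟨rfl, e1⟩ := ih e
    exact ⟨rfl, e1⟩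
  | bind a z x ih =>
    intro y r s e
    cases y <;> simp only [REWB.encode, List.cons_append, List.cons.injEq, reduceCtorEq,
      false_and, true_and, List.nil_append, QuerySymbol.letter.injEq, List.append_assoc] at e
    obtain ⟨rfl, e1⟩ := e
    obtain ⟨rfl, e2⟩ := isPrefixCode_encodeName e1
    obtain ⟨rfl, e3⟩ := ih e2
    exact ⟨rfl, e3⟩

/-- The string is a concatenation of prefix codes, which can be split off one after the other. The
lists then determine the vertex set, the edge set and the valuation. Hence membership in `evalE` can
be tested on one known instance. -/
theorem QueryInstance.EncodedBy.unique {I J : QueryInstance A} {x : List (QuerySymbol A)}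
    (hI : I.EncodedBy x) (hJ : J.EncodedBy x) : I = J := by
  obtain ⟨vs, es, bs, h1, h2, h3, rfl⟩ := hI
  obtain ⟨vs', es', bs', h1', h2', h3', e1⟩ := hJ
  simp only [List.append_assoc] at e1
  obtain ⟨rfl, e2⟩ := isPrefixCode_encodeName.encodeList e1
  obtain ⟨rfl, e3⟩ := isPrefixCode_encodeEdge.encodeList e2
  obtain ⟨h4, e4⟩ := isPrefixCode_encodeREWB e3
  obtain ⟨rfl, e5⟩ := isPrefixCode_encodeBinding.encodeList e4
  obtain ⟨h5, e6⟩ := isPrefixCode_encodeName e5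
  obtain ⟨h6, -⟩ := isPrefixCode_encodeName (r := []) (s := []) (by simpa using e6)
  obtain ⟨⟨V, E, _, _⟩, r, ν, u, v, _, _, _⟩ := I
  obtain ⟨⟨V', E', _, _⟩, r', ν', u', v', _, _, _⟩ := J
  obtain rfl : V = V' := Finset.ext fun x => (h1 x).symm.trans (h1' x)
  obtain rfl : E = E' := Finset.ext fun x => (h2 x).symm.trans (h2' x)
  obtain rfl : ν = ν' := funext fun x => (h3 x).trans (h3' x).symm
  dsimp only at h4 h5 h6
  subst h4 h5 h6
  rfl

variable (a : A)

/-- The string that represents the instance of a formula and a number. -/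
def instanceString (φ : BoolFormula) (k : ℕ) : List (QuerySymbol A) :=
  encodeList encodeName (vertexList (formulaEdges a φ 0 1 2 3).2) ++
    encodeList encodeEdge (formulaEdges a φ 0 1 2 3).1 ++ (query a k).encode ++
    encodeList encodeBinding [([], [])] ++ encodeName (mainVertex 0) ++ encodeName (mainVertex 1)

theorem encodedBy_instanceString (φ : BoolFormula) (k : ℕ) :
    (formulaInstance a φ k).EncodedBy (instanceString a φ k) := by
  refine ⟨_, _, [([], [])], fun u => ?_, fun t => (mem_formulaGraph_E a).symm,
    fun y => valOf_singleton y [], rfl⟩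
  classical exact List.mem_toFinset.symm

theorem instanceString_mem_evalE (φ : BoolFormula) (k m : ℕ) :
    (instanceString a φ k, m) ∈ evalE A 1 ↔
      m = (query a k).size ∧ ∃ S ⊆ φ.atoms, S.card = k ∧ φ.Sat S := by
  rw [← isYes_formulaInstance a]
  constructor
  · rintro ⟨I, -, h2, h3, h4⟩
    obtain rfl := h2.unique (encodedBy_instanceString a φ k)
    exact ⟨h3, h4⟩
  · rintro ⟨h1, h2⟩
    exact ⟨_, levelE_query a k, encodedBy_instanceString a φ k, h1, h2⟩

end Decode

/-! ### The commands of the reduction -/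

/-- The stack alphabet. -/
abbrev StackSym (A : Type) : Type := Option (QuerySymbol A)

instance QuerySymbol.instFinite {A : Type} [Finite A] : Finite (QuerySymbol A) := by
  let f : QuerySymbol A → (Bool ⊕ A) ⊕ Fin 14
    | .bit b => .inl (.inl b)
    | .letter a => .inl (.inr a)
    | .endName => .inr 0
    | .item => .inr 1
    | .endList => .inr 2
    | .condEq => .inr 3
    | .condNe => .inr 4
    | .condNot => .inr 5
    | .condAnd => .inr 6
    | .condOr => .inr 7
    | .eps => .inr 8
    | .test => .inr 9
    | .plus => .inr 10
    | .cat => .inr 11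
    | .star => .inr 12
    | .bind => .inr 13
  refine Finite.of_injective f fun x y h => ?_
  cases x <;> cases y <;> simp_all [f]

/-- The stacks of the reduction. -/
inductive Reg : Type
  | raw | inp | ks | N | P | X | T | out | size | C | O | D | E | s | t | f | err
  deriving DecidableEq

instance : Fintype Reg where
  elems := {.raw, .inp, .ks, .N, .P, .X, .T, .out, .size, .C, .O, .D, .E, .s, .t, .f, .err}
  complete x := by cases x <;> decide

/-- The contents of the stacks. -/
structure Regs (A : Type) : Type where
  raw : List (StackSym A) := []
  inp : List (StackSym A) := []
  ks : List (StackSym A) := []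
  N : List (StackSym A) := []
  P : List (StackSym A) := []
  X : List (StackSym A) := []
  T : List (StackSym A) := []
  out : List (StackSym A) := []
  size : List (StackSym A) := []
  C : List (StackSym A) := []
  O : List (StackSym A) := []
  D : List (StackSym A) := []
  E : List (StackSym A) := []
  s : List (StackSym A) := []
  t : List (StackSym A) := []
  f : List (StackSym A) := []
  err : List (StackSym A) := []

/-- The contents of a given stack. -/
@[simp] def Regs.get {A : Type} (R : Regs A) : Reg → List (StackSym A)
  | .raw => R.raw
  | .inp => R.inp
  | .ks => R.ks
  | .N => R.N
  | .P => R.P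
  | .X => R.X
  | .T => R.T
  | .out => R.out
  | .size => R.size
  | .C => R.C
  | .O => R.O
  | .D => R.D
  | .E => R.E
  | .s => R.s
  | .t => R.t
  | .f => R.f
  | .err => R.err

infixr:60 " ⨾ " => Frag.seq

-- Elementary stack commands

namespace Frag

theorem Runs.of_eq {K₁ K₂ : Type} [DecidableEq K₁] [DecidableEq K₂] {Γ₁ : K₁ → Type}
    {S₀ σ₁ : Type} {F : JFrag Γ₁ K₂ S₀ σ₁} {S S' S'' n n'} (h : F.Runs S n S') (hn : n ≤ n')
    (hS : S' = S'') : F.Runs S n' S'' := hS ▸ h.mono hn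

theorem Runs.of_start {K₁ K₂ : Type} [DecidableEq K₁] [DecidableEq K₂] {Γ₁ : K₁ → Type}
    {S₀ σ₁ : Type} {F : JFrag Γ₁ K₂ S₀ σ₁} {S S' S'' n} (h : F.Runs S n S') (hS : S'' = S) :
    F.Runs S'' n S' := hS ▸ h

variable {K₁ : Type} [DecidableEq K₁] {Γ₁ : K₁ → Type} {σ₁ : Type} {A : Type}

/-- Do nothing. -/
def nop : JFrag Γ₁ Reg (StackSym A) σ₁ where
  Λ := Unit
  fin := inferInstance
  entry := ()
  code _ := .goto fun _ => none

theorem runs_nop (S : Reg → List (StackSym A)) : (nop : JFrag Γ₁ Reg (StackSym A) σ₁).Runs S 1 S :=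
  fun v _ => ⟨v, 1, le_rfl, Run.step rfl (Run.exit _ _)⟩

/-- Push a list of symbols, such that the first one ends up on top. -/
def pushList (k : Reg) : List (StackSym A) → JFrag Γ₁ Reg (StackSym A) σ₁
  | [] => nop
  | s :: l => pushList k l ⨾ push k s

theorem runs_pushList (k : Reg) (l : List (StackSym A)) (S : Reg → List (StackSym A)) :
    (pushList k l : JFrag Γ₁ Reg (StackSym A) σ₁).Runs S (l.length + 1)
      (Function.update S k (l ++ S k)) := by
  induction l with
  | nil => exact (runs_nop S).of_eq le_rfl (by simp)
  | cons s l ih => exact (ih.seq (runs_push k s _)).of_eq (by simp) (by simp)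

variable [Finite A]

/-- Move the contents of a stack to another one, which reverses their order. -/
def move (src dst : Reg) : JFrag Γ₁ Reg (StackSym A) σ₁ := loop src (fun _ => false) fun s => push dst s

theorem runs_move {src dst : Reg} (h : src ≠ dst) {w : List (StackSym A)} {S : Reg → List (StackSym A)}
    (hw : S src = w) : (move src dst : JFrag Γ₁ Reg (StackSym A) σ₁).Runs S (2 * w.length + 1)
      (Function.update (Function.update S src []) dst (w.reverse ++ S dst)) := by
  induction w generalizing S with
  | nil =>
    have h0 : Function.update S src [] = S := by simp [← hw]
    refine (runs_loop_nil hw).of_eq (by simp) ?_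
    simp [h0]
  | cons s w ih =>
    refine (runs_loop_cons hw rfl (runs_push dst s _) (ih ?_)).of_eq ?_ ?_
    · simp [h]
    · simp; omega
    · funext r
      by_cases h1 : r = dst
      · subst h1; simp [h.symm]
      · by_cases h2 : r = src
        · subst h2; simp [h]
        · simp [h1, h2]

/-- Remove the contents of a stack. -/
def clear (k : Reg) : JFrag Γ₁ Reg (StackSym A) σ₁ := loop k (fun _ => false) fun _ => nop

theorem runs_clear {k : Reg} {w : List (StackSym A)} {S : Reg → List (StackSym A)} (hw : S k = w) :
    (clear k : JFrag Γ₁ Reg (StackSym A) σ₁).Runs S (2 * w.length + 1) (Function.update S k []) := by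
  induction w generalizing S with
  | nil =>
    refine (runs_loop_nil hw).of_eq (by simp) ?_
    simp [← hw]
  | cons s w ih =>
    refine (runs_loop_cons hw rfl (runs_nop _) (ih (by simp))).of_eq ?_ (by simp)
    simp; omega

/-- Move the contents of the stack `T` to two stacks. -/
def distribute (f g : StackSym A → JFrag Γ₁ Reg (StackSym A) σ₁) : JFrag Γ₁ Reg (StackSym A) σ₁ :=
  loop .T (fun _ => false) fun s => f s ⨾ g s

theorem runs_distribute {k l : Reg} (hk : k ≠ .T) (hl : l ≠ .T) (hkl : k ≠ l)
    (g : StackSym A → StackSym A) {w : List (StackSym A)} {S : Reg → List (StackSym A)} (hw : S .T = w) :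
    (distribute (fun s => push k s) (fun s => push l (g s)) : JFrag Γ₁ Reg (StackSym A) σ₁).Runs S
      (3 * w.length + 1) (Function.update (Function.update (Function.update S .T []) k
        (w.reverse ++ S k)) l ((w.map g).reverse ++ S l)) := by
  induction w generalizing S with
  | nil =>
    have h0 : Function.update S .T [] = S := by simp [← hw]
    refine (runs_loop_nil hw).of_eq (by simp) ?_
    simp [h0]
  | cons s w ih =>
    refine (runs_loop_cons hw rfl ((runs_push k s _).seq (runs_push l (g s) _)) (ih ?_)).of_eq ?_ ?_
    · simp [hk.symm, hl.symm]
    · simp; omega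
    · funext r
      by_cases h1 : r = l
      · subst h1; simp [hl, hkl.symm]
      · by_cases h2 : r = k
        · subst h2; simp [hk, h1]
        · by_cases h3 : r = .T
          · subst h3; simp [h1, h2]
          · simp [h1, h2, h3]

/-- Copy the contents of a stack to another one. -/
def copy (src dst : Reg) : JFrag Γ₁ Reg (StackSym A) σ₁ :=
  move src .T ⨾ distribute (fun s => push src s) (fun s => push dst (id s))

/-- The contents are reversed on the way to the auxiliary stack `T` and reversed again on the way
back, so the order is preserved. -/
theorem runs_copy {src dst : Reg} (h : src ≠ dst) (hs : src ≠ .T) (hd : dst ≠ .T)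
    {S : Reg → List (StackSym A)} (hT : S .T = []) :
    (copy src dst : JFrag Γ₁ Reg (StackSym A) σ₁).Runs S (5 * (S src).length + 2)
      (Function.update S dst (S src ++ S dst)) := by
  refine ((runs_move hs rfl).seq (runs_distribute hs hd h id rfl)).of_eq ?_ ?_
  · simp [hT]; omega
  · funext r
    by_cases h1 : r = dst
    · subst h1; simp [hd, h.symm, hT]
    · by_cases h2 : r = src
      · subst h2; simp [h1, hs, hT]
      · by_cases h3 : r = .T
        · subst h3; simp [h1, h2, hT]
        · simp [h1, h2, h3]

/-- The symbol that ends a name. -/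
abbrev endSym : StackSym A := some .endName

/-- The digit of unary numbers. -/
abbrev one : StackSym A := some (.bit true)

/-- The number `n` on a stack. -/
abbrev ones (n : ℕ) : List (StackSym A) := List.replicate n one

/-- Is this the end of a name? -/
def isEnd : StackSym A → Bool
  | some .endName => true
  | _ => false

/-- Push a name that consists of a fixed part and the contents of a stack. -/
def emitName (dst : Reg) (pre : List (StackSym A)) (src : Reg) : JFrag Γ₁ Reg (StackSym A) σ₁ :=
  push dst endSym ⨾ copy src dst ⨾ pushList dst pre

theorem runs_emitName {dst src : Reg} (pre : List (StackSym A)) {m : ℕ} {S : Reg → List (StackSym A)}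
    (h : src ≠ dst) (hs : src ≠ .T) (hd : dst ≠ .T) (hT : S .T = []) (hm : (S src).length ≤ m) :
    (emitName dst pre src : JFrag Γ₁ Reg (StackSym A) σ₁).Runs S (5 * m + pre.length + 4)
      (Function.update S dst (pre ++ (S src ++ endSym :: S dst))) := by
  refine ((runs_push _ _ _).seq ((runs_copy h hs hd ?_).seq (runs_pushList _ _ _))).of_eq ?_ ?_
  · simp [hd.symm, hT]
  · simp [h]; omega
  · simp [h]

/-- Move a name to another stack. -/
def readName (src dst : Reg) : JFrag Γ₁ Reg (StackSym A) σ₁ := loop src isEnd fun s => push dst s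

/-- Moving symbol by symbol reverses the name, which is invisible because it is unary. -/
theorem runs_readName {src dst : Reg} (h : src ≠ dst) {n m : ℕ} {w : List (StackSym A)}
    {S : Reg → List (StackSym A)} (hw : S src = ones n ++ endSym :: w) (hm : n ≤ m) :
    (readName src dst : JFrag Γ₁ Reg (StackSym A) σ₁).Runs S (2 * m + 1)
      (Function.update (Function.update S src w) dst (ones n ++ S dst)) := by
  refine Runs.mono ?_ (n := 2 * n + 1) (by omega)
  clear hm
  induction n generalizing S with
  | zero =>
    refine (runs_loop_stop hw rfl).of_eq (by omega) ?_
    simp [h.symm]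
  | succ n ih =>
    rw [ones, List.replicate_succ, List.cons_append] at hw
    refine (runs_loop_cons hw rfl (runs_push dst one _) (ih ?_)).of_eq ?_ ?_
    · simp [h]
    · omega
    · funext r
      by_cases h1 : r = dst
      · subst h1; simp [h.symm, List.replicate_succ']
      · by_cases h2 : r = src
        · subst h2; simp [h]
        · simp [h1, h2]

/-- Remove the top of a stack, up to the end of the first name. -/
def skipName (k : Reg) : JFrag Γ₁ Reg (StackSym A) σ₁ := loop k isEnd fun _ => nop

theorem runs_skipName {k : Reg} {v w : List (StackSym A)} {S : Reg → List (StackSym A)}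
    (hv : ∀ s ∈ v, isEnd s = false) (hw : S k = v ++ endSym :: w) :
    (skipName k : JFrag Γ₁ Reg (StackSym A) σ₁).Runs S (2 * v.length + 1) (Function.update S k w) := by
  induction v generalizing S with
  | nil => exact (runs_loop_stop hw rfl).of_eq (by simp) rfl
  | cons s v ih =>
    refine (runs_loop_cons hw (hv s (by simp)) (runs_nop _)
      (ih (fun s hs => hv s (List.mem_cons_of_mem _ hs)) (by simp))).of_eq ?_ (by simp)
    simp; omega

end Frag

namespace Frag

variable {K₁ : Type} [DecidableEq K₁] {Γ₁ : K₁ → Type} {σ₁ : Type} {A : Type} [Finite A]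

theorem runs_casePop_nil {k : Reg} {g : Option (StackSym A) → JFrag Γ₁ Reg (StackSym A) σ₁}
    {S n S'} (h : S k = []) (hg : (g none).Runs S n S') : (casePop k g).Runs S (n + 1) S' := by
  apply runs_casePop
  have h0 : Function.update S k [] = S := by simp [← h]
  rw [h]
  simpa [h0] using hg

theorem runs_casePop_cons {k : Reg} {g : Option (StackSym A) → JFrag Γ₁ Reg (StackSym A) σ₁}
    {S n S' s w} (h : S k = s :: w) (hg : (g (some s)).Runs (Function.update S k w) n S') :
    (casePop k g).Runs S (n + 1) S' := by
  apply runs_casePop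
  rw [h]
  exact hg

/-! ### Writing the query -/

/-- A string as the contents of a stack. -/
abbrev syms (l : List (QuerySymbol A)) : List (StackSym A) := l.map some

/-- Write the number `k` in unary on the stack `N`, and the condition `posCond k` on the
stack `P`. -/
def condCmd : JFrag Γ₁ Reg (StackSym A) σ₁ :=
  pushList .P (syms (posCond 0).encode) ⨾
    loop .ks (fun _ => false) fun _ => push .N one ⨾ emitName .P [some .condOr, some .condEq] .N

theorem runs_condCmd_loop (k j m : ℕ) (hm : j + k ≤ m) (inp out : List (StackSym A)) :
    (loop .ks (fun _ => false) fun _ =>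
      push .N one ⨾ emitName .P [some .condOr, some .condEq] .N :
        JFrag Γ₁ Reg (StackSym A) σ₁).Runs
      ({ inp := inp, ks := List.replicate k none, N := ones j, P := syms (posCond j).encode,
         out := out } : Regs A).get (k * (5 * m + 8) + 1)
      ({ inp := inp, N := ones (j + k), P := syms (posCond (j + k)).encode,
         out := out } : Regs A).get := by
  induction k generalizing j with
  | zero => exact (runs_loop_nil rfl).of_eq (by simp) rfl
  | succ k ih =>
    refine (runs_loop_cons (by rw [Regs.get, List.replicate_succ]) rfl
      ((runs_push .N one _).seq (runs_emitName _ (m := m) (by simp) (by simp) (by simp) ?_ ?_))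
      ((ih (j + 1) (by omega)).of_start ?_)).of_eq
      (n := 1 + (5 * m + 2 + 4) + (k * (5 * m + 8) + 1) + 1) ?_ ?_
    · simp
    · simp; omega
    · funext r
      cases r <;> simp [List.replicate_succ, posCond, Condition.encode, encodeName]
    · have := Nat.succ_mul k (5 * m + 8)
      simp only [Nat.succ_eq_add_one] at this
      omega
    · rw [Nat.add_right_comm j 1 k, Nat.add_assoc j k 1]

theorem length_encode_posCond (j : ℕ) :
    ((posCond j).encode : List (QuerySymbol A)).length ≤ (j + 2) ^ 2 := by
  induction j with
  | zero => simp [posCond, Condition.encode, encodeName]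
  | succ j ih =>
    simp only [posCond, Condition.encode, encodeName, List.length_cons, List.length_append,
      List.length_map, List.length_replicate, List.length_nil]
    nlinarith

theorem runs_condCmd (k : ℕ) (inp out : List (StackSym A)) :
    (condCmd : JFrag Γ₁ Reg (StackSym A) σ₁).Runs
      ({ inp := inp, ks := List.replicate k none, out := out } : Regs A).get
      (k * (5 * k + 8) + 4)
      ({ inp := inp, N := ones k, P := syms (posCond k).encode, out := out } : Regs A).get := by
  refine ((runs_pushList _ _ _).seq
    ((runs_condCmd_loop k 0 k (by omega) inp out).of_start ?_)).of_eq ?_ (by simp)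
  · funext r
    cases r <;> simp [posCond]
  · simp [posCond, Condition.encode, encodeName]; omega

/-- Write the innermost part of the query on the stack `X`. -/
def starCmd (a : A) : JFrag Γ₁ Reg (StackSym A) σ₁ :=
  pushList .X (syms [.test, .letter a, .condNe, .endName]) ⨾ copy .P .X ⨾
    pushList .X (syms [.test, .letter a, .condEq, .endName, .cat, .test, .letter a, .condNot]) ⨾
    copy .P .X ⨾ pushList .X (syms [.star, .plus, .cat, .test, .letter a])

/-- In prefix notation the string is assembled from its end, so that the finished expression can be
read from the top of the stack. -/
theorem runs_starCmd (a : A) (k m : ℕ) (inp out N P : List (StackSym A))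
    (hP : P = syms (posCond k).encode) (hm : P.length ≤ m) :
    (starCmd a : JFrag Γ₁ Reg (StackSym A) σ₁).Runs
      ({ inp := inp, N := N, P := P, out := out } : Regs A).get
      (10 * m + 24)
      ({ inp := inp, N := N, P := P, X := syms (starPart a k).encode, out := out } :
        Regs A).get := by
  refine ((runs_pushList _ _ _).seq ((runs_copy (by simp) (by simp) (by simp) ?_).seq
    ((runs_pushList _ _ _).seq ((runs_copy (by simp) (by simp) (by simp) ?_).seq
    (runs_pushList _ _ _))))).of_eq ?_ ?_
  · simp
  · simp
  · simp; omega
  · funext r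
    cases r <;> simp [starPart, REWB.encode, Condition.encode, encodeName, hP]

/-- Write the binding of one variable. -/
def bindCmd (a : A) : JFrag Γ₁ Reg (StackSym A) σ₁ :=
  skipName .P ⨾ copy .P .X ⨾ push .X (some .condNot) ⨾
    emitName .X [some .cat, some .test, some (.letter a), some .condAnd, some .condEq, one] .N ⨾
    emitName .X [some .bind, some (.letter a), one] .N

/-- `posCond (k + 1)` is `posCond k` behind the operator, the equality symbol and one name, so
skipping up to the end of that name produces the condition needed for the binder. The loop has
already popped one digit from `N`; the additional `one` in the fixed parts restores the variable `k
+ 1`. -/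
theorem runs_bindCmd (a : A) (k m : ℕ) (hm : (k + 2) ^ 2 ≤ m) (inp out : List (StackSym A))
    (r : REWB A) :
    (bindCmd a : JFrag Γ₁ Reg (StackSym A) σ₁).Runs
      ({ inp := inp, N := ones k, P := syms (posCond (k + 1)).encode, X := syms r.encode,
         out := out } : Regs A).get
      (17 * m + 27)
      ({ inp := inp, N := ones k, P := syms (posCond k).encode,
         X := syms (REWB.bind a (unary (k + 1)) (.cat (.test a (.and (.eq (unary (k + 1)))
          (.not (posCond k)))) r)).encode, out := out } : Regs A).get := by
  have hk : k + 4 ≤ m := by nlinarith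
  have hl := (length_encode_posCond (A := A) k).trans hm
  refine ((runs_skipName (k := .P) (v := some .condOr :: some .condEq :: ones (k + 1))
    (w := syms (posCond k).encode) ?_ ?_).seq ((runs_copy (by simp) (by simp) (by simp) ?_).seq
    ((runs_push _ _ _).seq ((runs_emitName _ (m := m) (by simp) (by simp) (by simp) ?_ ?_).seq
    (runs_emitName _ (m := m) (by simp) (by simp) (by simp) ?_ ?_))))).of_eq ?_ ?_
  · intro s hs
    rcases List.mem_cons.1 hs with rfl | hs
    · rfl
    rcases List.mem_cons.1 hs with rfl | hs
    · rfl
    · rw [List.eq_of_mem_replicate hs]; rfl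
  · simp [posCond, Condition.encode, encodeName]
  · simp
  · simp
  · simp; omega
  · simp
  · simp; omega
  · simp; omega
  · funext r
    cases r <;> simp [REWB.encode, Condition.encode, encodeName, List.replicate_succ]

/-- Write the part of the query that binds the variables. -/
def wrapCmd (a : A) : JFrag Γ₁ Reg (StackSym A) σ₁ := loop .N (fun _ => false) fun _ => bindCmd a

theorem runs_wrapCmd (a : A) (k m : ℕ) (hm : (k + 2) ^ 2 ≤ m) (inp out : List (StackSym A))
    (r : REWB A) :
    (wrapCmd a : JFrag Γ₁ Reg (StackSym A) σ₁).Runs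
      ({ inp := inp, N := ones k, P := syms (posCond k).encode, X := syms r.encode,
         out := out } : Regs A).get
      (k * (17 * m + 28) + 1)
      ({ inp := inp, P := syms (posCond 0).encode, X := syms (wrap a k r).encode,
         out := out } : Regs A).get := by
  induction k generalizing r with
  | zero => exact (runs_loop_nil rfl).of_eq (by simp) rfl
  | succ k ih =>
    have hk : (k + 2) ^ 2 ≤ m := (Nat.pow_le_pow_left (by omega) 2).trans hm
    refine (runs_loop_cons (by rw [Regs.get, ones, List.replicate_succ]) rfl
      ((runs_bindCmd a k m hk inp out r).of_start ?_) (ih hk _)).of_eq ?_ rfl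
    · funext r
      cases r <;> simp
    · have := Nat.succ_mul k (17 * m + 28)
      simp only [Nat.succ_eq_add_one] at this
      omega

theorem length_encode_wrap (a : A) (j m : ℕ) (hm : (j + 2) ^ 2 ≤ m) (r : REWB A) :
    (wrap a j r).encode.length ≤ r.encode.length + j * (3 * m + 10) := by
  induction j generalizing r with
  | zero => simp [wrap]
  | succ j ih =>
    have hj : (j + 2) ^ 2 ≤ m := (Nat.pow_le_pow_left (by omega) 2).trans hm
    refine (ih hj _).trans ?_
    have := (length_encode_posCond (A := A) j).trans hj
    have : 2 * (j + 1) ≤ 2 * m := by nlinarith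
    simp only [REWB.encode, Condition.encode, encodeName, List.length_cons, List.length_append,
      List.length_map, List.length_replicate, List.length_nil]
    have := Nat.succ_mul j (3 * m + 10)
    simp only [Nat.succ_eq_add_one] at this
    omega

theorem length_encode_query (a : A) (k m : ℕ) (hm : (k + 2) ^ 2 ≤ m) :
    (query a k).encode.length ≤ (k + 1) * (3 * m + 20) := by
  refine (length_encode_wrap a k m hm _).trans ?_
  have := (length_encode_posCond (A := A) k).trans hm
  simp only [starPart, REWB.encode, Condition.encode, encodeName, List.length_cons,
    List.length_append, List.length_map, List.length_nil]
  nlinarith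

/-- Move the query to the output, and its size in unary to the stack `size`. -/
def queryCmd (a : A) : JFrag Γ₁ Reg (StackSym A) σ₁ :=
  condCmd ⨾ starCmd a ⨾ wrapCmd a ⨾ clear .P ⨾ move .X .T ⨾
    distribute (fun s => push .out s) (fun _ => push .size none)

/-- While the query moves to the output, each of its symbols also puts a `none` on the stack `size`.
This is the new parameter in unary. -/
theorem runs_queryCmd (a : A) (k m : ℕ) (hm : (k + 2) ^ 2 ≤ m) (inp out : List (StackSym A)) :
    (queryCmd a : JFrag Γ₁ Reg (StackSym A) σ₁).Runs
      ({ inp := inp, ks := List.replicate k none, out := out } : Regs A).get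
      ((k + 1) * (50 * m + 200))
      ({ inp := inp, out := syms (query a k).encode ++ out,
         size := List.replicate (query a k).size none } : Regs A).get := by
  have hP := (length_encode_posCond (A := A) k).trans hm
  have hX := length_encode_query a k m hm
  refine ((runs_condCmd k inp out).seq ((runs_starCmd a k m _ _ _ _ rfl (by simpa using hP)).seq
    ((runs_wrapCmd a k m hm inp out _).seq ((runs_clear (k := .P) rfl).seq
    ((runs_move (src := .X) (dst := .T) (by simp) rfl).seq
    (runs_distribute (k := .out) (l := .size) (by simp) (by simp) (by simp) (fun _ => none)
      rfl)))))).of_eq ?_ ?_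
  · have h2 : k ≤ m := by nlinarith
    have h3 : k * (5 * k) ≤ k * (5 * m) := by gcongr
    have h4 : ((wrap a k (starPart a k)).encode).length ≤ _ := hX
    simp [posCond, Condition.encode, encodeName, -List.map_replicate]
    nlinarith
  · funext r
    cases r <;> simp [query, REWB.size, Function.comp_def]

end Frag

/-! ### Reading the formula -/

/-- The state of the traversal of a formula: the pending subformulas, each with the vertex where it
is evaluated and its two exits; the digits of an atom read so far, in reverse; the first unused
vertex; the edges; the number of errors. -/
structure ParseState (A : Type) : Type where
  obls : List (ℕ × ℕ × ℕ)
  part : List Bool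
  next : ℕ
  edges : List (Name × A × Name × Name)
  bad : ℕ

namespace ParseState

variable {A : Type}

/-- Read an operator that replaces the next pending subformula by `g`. -/
def operator (σ : ParseState A) (g : ℕ × ℕ × ℕ → List (ℕ × ℕ × ℕ)) (i : ℕ) : ParseState A :=
  match σ.part, σ.obls with
  | _ :: p, _ => { σ with part := p, bad := σ.bad + 1 }
  | [], [] => { σ with bad := σ.bad + 1 }
  | [], o :: os => { σ with obls := g o ++ os, next := σ.next + i }

/-- Read the end of an atom. -/
def endAtom (a : A) (σ : ParseState A) : ParseState A :=
  match σ.obls with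
  | [] => { σ with bad := σ.bad + 1 }
  | o :: os =>
    { obls := os
      part := []
      next := σ.next + 1
      edges := atomEdges a σ.part.reverse o.1 o.2.1 o.2.2 σ.next ++ σ.edges
      bad := σ.bad }

/-- Read a symbol. -/
def step (a : A) (σ : ParseState A) : FormulaSymbol → ParseState A
  | .bit b => { σ with part := b :: σ.part }
  | .endName => σ.endAtom a
  | .neg => σ.operator (fun o => [(o.1, o.2.2, o.2.1)]) 0
  | .conj => σ.operator (fun o => [(o.1, σ.next, o.2.2), (σ.next, o.2.1, o.2.2)]) 1
  | .disj => σ.operator (fun o => [(o.1, o.2.1, σ.next), (σ.next, o.2.1, o.2.2)]) 1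

/-- The state before the first symbol. -/
def init : ParseState A := ⟨[(0, 1, 2)], [], 3, [], 0⟩

/-- A formula has been read completely. -/
def Accepting (σ : ParseState A) : Prop := σ.bad = 0 ∧ σ.obls = [] ∧ σ.part = []

theorem foldl_step_bits (a : A) (σ : ParseState A) (p : List Bool) :
    (p.map FormulaSymbol.bit).foldl (step a) σ = { σ with part := p.reverse ++ σ.part } := by
  induction p generalizing σ with
  | nil => rfl
  | cons b p ih => simp [ih, step]

/-- A formula in prefix notation consumes exactly the topmost pending subformula, and vertices are
allocated in the order of `formulaEdges`. The edges written later come first there, since the output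
is a stack. -/
theorem foldl_step_encode (a : A) (φ : BoolFormula) (s t f n : ℕ) (os : List (ℕ × ℕ × ℕ))
    (es : List (Name × A × Name × Name)) :
    φ.encode.foldl (step a) ⟨(s, t, f) :: os, [], n, es, 0⟩ =
      ⟨os, [], (formulaEdges a φ s t f n).2, (formulaEdges a φ s t f n).1 ++ es, 0⟩ := by
  induction φ generalizing s t f n os es with
  | atom p => simp [BoolFormula.encode, foldl_step_bits, step, endAtom, formulaEdges]
  | neg φ ih => simp [BoolFormula.encode, step, operator, ih, formulaEdges]
  | conj φ ψ h₁ h₂ => simp [BoolFormula.encode, step, operator, h₁, h₂, formulaEdges]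
  | disj φ ψ h₁ h₂ => simp [BoolFormula.encode, step, operator, h₁, h₂, formulaEdges]

theorem bad_le_bad_step (a : A) (σ : ParseState A) (c : FormulaSymbol) :
    σ.bad ≤ (σ.step a c).bad := by
  rcases σ with ⟨_ | ⟨o, os⟩, _ | ⟨b, p⟩, n, es, m⟩ <;> cases c <;> simp [step, endAtom, operator]

theorem bad_le_bad_foldl (a : A) (σ : ParseState A) (x : List FormulaSymbol) :
    σ.bad ≤ (x.foldl (step a) σ).bad := by
  induction x generalizing σ with
  | nil => exact le_rfl
  | cons c x ih => exact (bad_le_bad_step a σ c).trans (ih _)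

/-- Backwards along the input: each pending subformula accounts for one formula in the unread rest,
preceded by the digits of a partially read atom. An operator merges the formulas at the head of the
list into one. -/
theorem exists_encode_of_accepting (a : A) (x : List FormulaSymbol) (σ : ParseState A)
    (h : (x.foldl (step a) σ).Accepting) :
    ∃ φs : List BoolFormula, φs.length = σ.obls.length ∧
      σ.part.reverse.map FormulaSymbol.bit ++ x = φs.flatMap BoolFormula.encode := by
  induction x generalizing σ with
  | nil =>
    obtain ⟨-, h1, h2⟩ := h
    simp only [List.foldl_nil] at h1 h2
    exact ⟨[], by simp [h1], by simp [h2]⟩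
  | cons c x ih =>
    -- The number of errors never decreases, so none at the end means none on the way.
    have hb : σ.bad = 0 ∧ (σ.step a c).bad = 0 := by
      have h1 := bad_le_bad_foldl a (σ.step a c) x
      have h2 := bad_le_bad_step a σ c
      have h3 : ((c :: x).foldl (step a) σ).bad = 0 := h.1
      simp only [List.foldl_cons] at h3
      omega
    obtain ⟨φs, hl, he⟩ := ih _ h
    rcases σ with ⟨os, p, n, es, m⟩
    obtain ⟨rfl, hb⟩ := hb
    cases c with
    | bit b => exact ⟨φs, hl, by simpa [step] using he⟩
    | endName =>
      rcases os with _ | ⟨o, os⟩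
      · simp [step, endAtom] at hb
      · refine ⟨.atom p.reverse :: φs, by simpa [step, endAtom] using hl, ?_⟩
        simpa [step, endAtom, BoolFormula.encode] using he
    | neg =>
      rcases p with _ | ⟨b, p⟩ <;> rcases os with _ | ⟨o, os⟩ <;>
        simp only [step, operator, Nat.zero_add, one_ne_zero] at hb
      rcases φs with _ | ⟨φ, φs⟩
      · simp [step, operator] at hl
      refine ⟨.neg φ :: φs, by simpa [step, operator] using hl, ?_⟩
      simpa [step, operator, BoolFormula.encode] using he
    | conj =>
      rcases p with _ | ⟨b, p⟩ <;> rcases os with _ | ⟨o, os⟩ <;>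
        simp only [step, operator, Nat.zero_add, one_ne_zero] at hb
      rcases φs with _ | ⟨φ, _ | ⟨ψ, φs⟩⟩
      · simp [step, operator] at hl
      · simp [step, operator] at hl
      refine ⟨.conj φ ψ :: φs, by simpa [step, operator] using hl, ?_⟩
      simpa [step, operator, BoolFormula.encode] using he
    | disj =>
      rcases p with _ | ⟨b, p⟩ <;> rcases os with _ | ⟨o, os⟩ <;>
        simp only [step, operator, Nat.zero_add, one_ne_zero] at hb
      rcases φs with _ | ⟨φ, _ | ⟨ψ, φs⟩⟩
      · simp [step, operator] at hl
      · simp [step, operator] at hl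
      refine ⟨.disj φ ψ :: φs, by simpa [step, operator] using hl, ?_⟩
      simpa [step, operator, BoolFormula.encode] using he

theorem accepting_foldl_init_iff (a : A) (x : List FormulaSymbol) :
    (x.foldl (step a) init).Accepting ↔ ∃ φ : BoolFormula, x = φ.encode := by
  constructor
  · intro h
    obtain ⟨φs, hl, he⟩ := exists_encode_of_accepting a x _ h
    obtain ⟨φ, rfl⟩ := List.length_eq_one_iff.1 (hl.trans rfl)
    exact ⟨φ, by simpa [init] using he⟩
  · rintro ⟨φ, rfl⟩
    rw [init, foldl_step_encode]
    exact ⟨rfl, rfl, rfl⟩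

/-- All numbers in the state are at most `m`. -/
def Bounded (m : ℕ) (σ : ParseState A) : Prop :=
  σ.next ≤ m ∧ σ.part.length ≤ m ∧ σ.obls.length ≤ m ∧ σ.bad ≤ m ∧
    ∀ o ∈ σ.obls, o.1 ≤ m ∧ o.2.1 ≤ m ∧ o.2.2 ≤ m

/-- Every number in the state grows by at most one per symbol. All of them are thus linear in the
length of the input, which keeps each command linear. -/
theorem Bounded.step {m : ℕ} {σ : ParseState A} (h : σ.Bounded m) (a : A) (c : FormulaSymbol) :
    (σ.step a c).Bounded (m + 1) := by
  rcases σ with ⟨_ | ⟨o, os⟩, _ | ⟨b, p⟩, n, es, k⟩ <;> obtain ⟨h1, h2, h3, h4, h5⟩ := h <;>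
    cases c <;>
    simp only [List.length_cons, List.length_nil, List.mem_cons, forall_eq_or_imp,
      List.not_mem_nil, false_imp_iff, implies_true, and_true] at h1 h2 h3 h4 h5 <;>
    simp only [ParseState.step, operator, endAtom, Bounded, List.length_cons, List.length_nil,
      List.mem_cons, forall_eq_or_imp, List.cons_append, List.nil_append, List.not_mem_nil,
      false_imp_iff, implies_true, and_true] <;>
    grind

end ParseState

-- The traversal of the formula as a stack program

namespace Frag

variable {K₁ : Type} [DecidableEq K₁] {Γ₁ : K₁ → Type} {σ₁ : Type} {A : Type} [Finite A]

/-- A symbol of a formula in the stack alphabet. -/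
def formulaSym : FormulaSymbol → StackSym A
  | .bit b => some (.bit b)
  | .endName => some .endName
  | .neg => some .condNot
  | .conj => some .condAnd
  | .disj => some .condOr

/-- A pending subformula on a stack. -/
def oblSyms (o : ℕ × ℕ × ℕ) : List (StackSym A) :=
  some .item :: (ones o.1 ++ endSym :: (ones o.2.1 ++ endSym :: (ones o.2.2 ++ [endSym])))

/-- The stacks for a state of the traversal. -/
def parseRegs (σ : ParseState A) (inp out size : List (StackSym A)) : Regs A where
  inp := inp
  out := syms (σ.edges.flatMap fun e => .item :: encodeEdge e) ++ out
  size := size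
  C := ones σ.next
  O := σ.obls.flatMap oblSyms
  D := σ.part.map fun b => some (.bit b)
  err := List.replicate σ.bad endSym

/-- Read the top pending subformula. -/
def readObl : JFrag Γ₁ Reg (StackSym A) σ₁ := readName .O .s ⨾ readName .O .t ⨾ readName .O .f

/-- The symbol `item` in front has already been popped by the test for emptiness; hence it is put
back in the hypothesis. -/
theorem runs_readObl {m : ℕ} {o : ℕ × ℕ × ℕ} (ho : o.1 ≤ m ∧ o.2.1 ≤ m ∧ o.2.2 ≤ m)
    {w : List (StackSym A)} {S : Reg → List (StackSym A)} (hO : some .item :: S .O = oblSyms o ++ w)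
    (hs : S .s = []) (ht : S .t = []) (hf : S .f = []) :
    (readObl : JFrag Γ₁ Reg (StackSym A) σ₁).Runs S (6 * m + 3)
      (Function.update (Function.update (Function.update (Function.update S .O w) .s (ones o.1)) .t
        (ones o.2.1)) .f (ones o.2.2)) := by
  simp only [oblSyms, List.cons_append, List.append_assoc, List.cons.injEq, true_and] at hO
  refine ((runs_readName (by simp) hO ho.1).seq ((runs_readName (by simp)
    (w := ones o.2.2 ++ endSym :: w) ?_ ho.2.1).seq
    (runs_readName (by simp) (w := w) ?_ ho.2.2))).of_eq ?_ ?_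
  · simp
  · simp
  · omega
  · funext r
    cases r <;> simp [hs, ht, hf]

/-- Write a pending subformula. -/
def writeObl (x y z : Reg) : JFrag Γ₁ Reg (StackSym A) σ₁ :=
  emitName .O [] z ⨾ emitName .O [] y ⨾ emitName .O [some .item] x

theorem runs_writeObl {x y z : Reg} {m i j k : ℕ} {S : Reg → List (StackSym A)}
    (hx : x ≠ .O ∧ x ≠ .T) (hy : y ≠ .O ∧ y ≠ .T) (hz : z ≠ .O ∧ z ≠ .T) (hT : S .T = [])
    (hi : i ≤ m) (hj : j ≤ m) (hk : k ≤ m)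
    (hxi : S x = ones i) (hyj : S y = ones j) (hzk : S z = ones k) :
    (writeObl x y z : JFrag Γ₁ Reg (StackSym A) σ₁).Runs S (15 * m + 13)
      (Function.update S .O (oblSyms (i, j, k) ++ S .O)) := by
  refine ((runs_emitName _ (m := m) hz.1 hz.2 (by simp) hT ?_).seq
    ((runs_emitName _ (m := m) hy.1 hy.2 (by simp) ?_ ?_).seq
    (runs_emitName _ (m := m) hx.1 hx.2 (by simp) ?_ ?_))).of_eq ?_ ?_
  · simpa [hzk] using hk
  · simpa using hT
  · simpa [hy.1, hyj] using hj
  · simpa using hT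
  · simpa [hx.1, hxi] using hi
  · simp; omega
  · simp [hx.1, hy.1, oblSyms, hxi, hyj, hzk]

/-- Remove the subformula that has been read. -/
def clearObl : JFrag Γ₁ Reg (StackSym A) σ₁ := clear .s ⨾ clear .t ⨾ clear .f

theorem runs_clearObl {m : ℕ} {S : Reg → List (StackSym A)} (hs : (S .s).length ≤ m)
    (ht : (S .t).length ≤ m) (hf : (S .f).length ≤ m) :
    (clearObl : JFrag Γ₁ Reg (StackSym A) σ₁).Runs S (6 * m + 3)
      (Function.update (Function.update (Function.update S .s []) .t []) .f []) :=
  ((runs_clear rfl).seq ((runs_clear rfl).seq (runs_clear rfl))).of_eq (by simp; omega) rfl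

/-- Write an edge. Each vertex and the data value consist of a fixed part and the contents of a
stack. -/
def writeEdge (a : A) (u : List (StackSym A)) (ru : Reg) (d : List (StackSym A)) (rd : Reg)
    (v : List (StackSym A)) (rv : Reg) : JFrag Γ₁ Reg (StackSym A) σ₁ :=
  emitName .out v rv ⨾ emitName .out (some (.letter a) :: d) rd ⨾
    emitName .out (some .item :: u) ru

theorem runs_writeEdge (a : A) {u d v : List Bool} {ru rd rv : Reg} {m : ℕ}
    {S : Reg → List (StackSym A)} {nu nd nv : List Bool}
    (hu : ru ≠ .out ∧ ru ≠ .T) (hd : rd ≠ .out ∧ rd ≠ .T) (hv : rv ≠ .out ∧ rv ≠ .T)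
    (hT : S .T = []) (hnu : nu.length ≤ m) (hnd : nd.length ≤ m) (hnv : nv.length ≤ m)
    (hSu : S ru = nu.map fun b => some (.bit b)) (hSd : S rd = nd.map fun b => some (.bit b))
    (hSv : S rv = nv.map fun b => some (.bit b))
    (hlu : u.length ≤ 1) (hld : d.length ≤ 1) (hlv : v.length ≤ 1) :
    (writeEdge a (u.map fun b => some (.bit b)) ru (d.map fun b => some (.bit b)) rd
      (v.map fun b => some (.bit b)) rv : JFrag Γ₁ Reg (StackSym A) σ₁).Runs S (15 * m + 17)
      (Function.update S .out
        (syms (.item :: encodeEdge (u ++ nu, a, d ++ nd, v ++ nv)) ++ S .out)) := by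
  refine ((runs_emitName _ (m := m) hv.1 hv.2 (by simp) hT ?_).seq
    ((runs_emitName _ (m := m) hd.1 hd.2 (by simp) ?_ ?_).seq
    (runs_emitName _ (m := m) hu.1 hu.2 (by simp) ?_ ?_))).of_eq ?_ ?_
  · simpa [hSv] using hnv
  · simpa using hT
  · simpa [hd.1, hSd] using hnd
  · simpa using hT
  · simpa [hu.1, hSu] using hnu
  · simp; omega
  · simp [hu.1, hd.1, hSu, hSd, hSv, encodeEdge, encodeName, Function.comp_def]

/-- Write the edges for an atom. -/
def writeAtom (a : A) : JFrag Γ₁ Reg (StackSym A) σ₁ :=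
  writeEdge a [] .raw [one] .E [some (.bit false)] .raw ⨾
    writeEdge a [some (.bit false)] .raw [one] .E [] .raw ⨾
    writeEdge a [] .s [one] .E [some (.bit false)] .C ⨾
    writeEdge a [some (.bit false)] .C [] .raw [] .t ⨾
    writeEdge a [some (.bit false)] .C [some (.bit false)] .raw [] .f

theorem runs_writeAtom (a : A) {m : ℕ} {S : Reg → List (StackSym A)} {p : List Bool}
    {s t f n : ℕ} (hT : S .T = []) (hraw : S .raw = []) (hp : p.length ≤ m)
    (hE : S .E = p.map fun b => some (.bit b)) (hs : s ≤ m) (ht : t ≤ m) (hf : f ≤ m) (hn : n ≤ m)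
    (hSs : S .s = ones s) (hSt : S .t = ones t) (hSf : S .f = ones f) (hSC : S .C = ones n) :
    (writeAtom a : JFrag Γ₁ Reg (StackSym A) σ₁).Runs S (75 * m + 85)
      (Function.update S .out
        (syms ((atomEdges a p s t f n).flatMap fun e => .item :: encodeEdge e) ++ S .out)) := by
  refine ((runs_writeEdge a (m := m) (u := []) (d := [true]) (v := [false]) (ru := .raw)
      (rd := .E) (rv := .raw) (nu := []) (nd := p) (nv := [])
      (by simp) (by simp) (by simp) ?_ ?_ ?_ ?_ ?_ ?_ ?_ ?_ ?_ ?_).seq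
    ((runs_writeEdge a (m := m) (u := [false]) (d := [true]) (v := []) (ru := .raw)
      (rd := .E) (rv := .raw) (nu := []) (nd := p) (nv := [])
      (by simp) (by simp) (by simp) ?_ ?_ ?_ ?_ ?_ ?_ ?_ ?_ ?_ ?_).seq
    ((runs_writeEdge a (m := m) (u := []) (d := [true]) (v := [false]) (ru := .s)
      (rd := .E) (rv := .C) (nu := unary s) (nd := p) (nv := unary n)
      (by simp) (by simp) (by simp) ?_ ?_ ?_ ?_ ?_ ?_ ?_ ?_ ?_ ?_).seq
    ((runs_writeEdge a (m := m) (u := [false]) (d := []) (v := []) (ru := .C)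
      (rd := .raw) (rv := .t) (nu := unary n) (nd := []) (nv := unary t)
      (by simp) (by simp) (by simp) ?_ ?_ ?_ ?_ ?_ ?_ ?_ ?_ ?_ ?_).seq
    (runs_writeEdge a (m := m) (u := [false]) (d := [false]) (v := []) (ru := .C)
      (rd := .raw) (rv := .f) (nu := unary n) (nd := []) (nv := unary f)
      (by simp) (by simp) (by simp) ?_ ?_ ?_ ?_ ?_ ?_ ?_ ?_ ?_ ?_))))).of_eq (by omega) ?_
  -- Each of the five edges leaves ten side conditions; the goal after them compares the final
  -- stacks.
  case refine_51 => simp [atomEdges, mainVertex, midVertex]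
  all_goals first | simpa using hT | simp [hraw, hE, hSs, hSt, hSf, hSC, hp, hs, ht, hf, hn]

/-- Process the end of an atom. -/
def atomCmd (a : A) : JFrag Γ₁ Reg (StackSym A) σ₁ :=
  casePop .O fun o => o.elim (push .err endSym) fun _ =>
    readObl ⨾ move .D .E ⨾ writeAtom a ⨾ push .C one ⨾ clear .E ⨾ clearObl

theorem runs_atomCmd (a : A) {σ : ParseState A} {m : ℕ} (hσ : σ.Bounded m)
    (inp out size : List (StackSym A)) :
    (atomCmd a : JFrag Γ₁ Reg (StackSym A) σ₁).Runs (parseRegs σ inp out size).get (100 * m + 200)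
      (parseRegs (σ.endAtom a) inp out size).get := by
  rcases σ with ⟨_ | ⟨o, os⟩, p, n, es, k⟩
  · refine (runs_casePop_nil (by simp [parseRegs]) (runs_push _ _ _)).of_eq (by omega) ?_
    funext r
    cases r <;> simp [parseRegs, ParseState.endAtom, List.replicate_succ]
  · obtain ⟨hn, hp, -, -, ho⟩ := hσ
    have ho := ho o (by simp)
    simp only at hn hp
    have h1 : (some .item : StackSym A) :: (parseRegs ⟨o :: os, p, n, es, k⟩ inp out size).O.tail =
        oblSyms o ++ os.flatMap oblSyms := by simp [parseRegs, oblSyms]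
    refine (runs_casePop_cons (s := some .item) (by simp [parseRegs, oblSyms]; rfl)
      ((runs_readObl ho (w := os.flatMap oblSyms) ?_ ?_ ?_ ?_).seq
      ((runs_move (by simp) rfl).seq
      ((runs_writeAtom a (m := m) (p := p.reverse) (s := o.1) (t := o.2.1) (f := o.2.2) (n := n)
        ?_ ?_ ?_ ?_ ho.1 ho.2.1 ho.2.2 hn ?_ ?_ ?_ ?_).seq
      ((runs_push _ _ _).seq ((runs_clear rfl).seq
      (runs_clearObl (m := m) ?_ ?_ ?_))))))).of_eq ?_ ?_
    case refine_16 =>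
      simp [parseRegs]
      omega
    case refine_17 =>
      funext r
      cases r <;> simp [parseRegs, ParseState.endAtom, List.replicate_succ]
    all_goals simp [parseRegs, oblSyms, hp, ho]

/-- Process an operator. -/
def operatorCmd (c : JFrag Γ₁ Reg (StackSym A) σ₁) : JFrag Γ₁ Reg (StackSym A) σ₁ :=
  casePop .D fun b => b.elim (casePop .O fun o => o.elim (push .err endSym) fun _ =>
    readObl ⨾ c ⨾ clearObl) fun _ => push .err endSym

/-- Emptiness of `D` is tested by popping. This is why `ParseState.operator` drops a digit when an
operator interrupts an atom. -/
theorem runs_operatorCmd {c : JFrag Γ₁ Reg (StackSym A) σ₁} {σ : ParseState A} {m i : ℕ}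
    {g : ℕ × ℕ × ℕ → List (ℕ × ℕ × ℕ)} (hσ : σ.Bounded m) (inp out size : List (StackSym A))
    (hc : ∀ o : ℕ × ℕ × ℕ, o.1 ≤ m ∧ o.2.1 ≤ m ∧ o.2.2 ≤ m → ∀ S : Reg → List (StackSym A),
      S .T = [] → S .s = ones o.1 → S .t = ones o.2.1 → S .f = ones o.2.2 →
      S .C = ones σ.next → c.Runs S (30 * m + 27) (Function.update (Function.update S .O
        ((g o).flatMap oblSyms ++ S .O)) .C (ones (σ.next + i)))) :
    (operatorCmd c).Runs (parseRegs σ inp out size).get (100 * m + 200)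
      (parseRegs (σ.operator g i) inp out size).get := by
  rcases σ with ⟨_ | ⟨o, os⟩, _ | ⟨b, p⟩, n, es, k⟩
  · refine (runs_casePop_nil (by simp [parseRegs]) (runs_casePop_nil (by simp [parseRegs])
      (runs_push _ _ _))).of_eq (by omega) ?_
    funext r
    cases r <;> simp [parseRegs, ParseState.operator, List.replicate_succ]
  · refine (runs_casePop_cons (s := some (.bit b)) (by simp [parseRegs]; rfl)
      (runs_push _ _ _)).of_eq (by omega) ?_
    funext r
    cases r <;> simp [parseRegs, ParseState.operator, List.replicate_succ]
  · have ho := hσ.2.2.2.2 o (by simp)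
    refine (runs_casePop_nil (by simp [parseRegs]) (runs_casePop_cons (s := some .item)
      (by simp [parseRegs, oblSyms]; rfl)
      ((runs_readObl ho (w := os.flatMap oblSyms) ?_ ?_ ?_ ?_).seq
      ((hc o ho _ ?_ ?_ ?_ ?_ ?_).seq (runs_clearObl (m := m) ?_ ?_ ?_))))).of_eq ?_ ?_
    case refine_13 => omega
    case refine_14 =>
      funext r
      cases r <;> simp [parseRegs, ParseState.operator]
    all_goals simp [parseRegs, oblSyms, ho]
  · refine (runs_casePop_cons (s := some (.bit b)) (by simp [parseRegs]; rfl)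
      (runs_push _ _ _)).of_eq (by omega) ?_
    funext r
    cases r <;> simp [parseRegs, ParseState.operator, List.replicate_succ]

/-- Process a symbol of the formula. -/
def symbolCmd (a : A) : StackSym A → JFrag Γ₁ Reg (StackSym A) σ₁
  | some (.bit b) => push .D (some (.bit b))
  | some .endName => atomCmd a
  | some .condNot => operatorCmd (writeObl .s .f .t)
  | some .condAnd => operatorCmd (writeObl .C .t .f ⨾ writeObl .s .C .f ⨾ push .C one)
  | some .condOr => operatorCmd (writeObl .C .t .f ⨾ writeObl .s .t .C ⨾ push .C one)
  | _ => nop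

theorem runs_symbolCmd (a : A) {σ : ParseState A} {m : ℕ} (hσ : σ.Bounded m) (c : FormulaSymbol)
    (inp out size : List (StackSym A)) :
    (symbolCmd a (formulaSym c) : JFrag Γ₁ Reg (StackSym A) σ₁).Runs
      (parseRegs σ inp out size).get (100 * m + 200)
      (parseRegs (σ.step a c) inp out size).get := by
  have hn := hσ.1
  cases c with
  | bit b =>
    refine (runs_push _ _ _).of_eq (by omega) ?_
    funext r
    cases r <;> simp [parseRegs, ParseState.step]
  | endName => exact runs_atomCmd a hσ inp out size
  | neg =>
    refine runs_operatorCmd hσ inp out size fun o ho S hT hs ht hf hC => ?_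
    refine (runs_writeObl (m := m) (by simp) (by simp) (by simp) hT ho.1 ho.2.2 ho.2.1 hs hf
      ht).of_eq (by omega) ?_
    funext r
    cases r <;> simp [hC]
  | conj =>
    refine runs_operatorCmd hσ inp out size fun o ho S hT hs ht hf hC => ?_
    refine ((runs_writeObl (m := m) (by simp) (by simp) (by simp) hT hn ho.2.1 ho.2.2 hC ht hf).seq
      ((runs_writeObl (m := m) (by simp) (by simp) (by simp) (by simpa using hT) ho.1 hn ho.2.2
      (by simpa using hs) (by simpa using hC) (by simpa using hf)).seq (runs_push _ _ _))).of_eq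
      (by omega) ?_
    funext r
    cases r <;> simp [hC, List.replicate_succ]
  | disj =>
    refine runs_operatorCmd hσ inp out size fun o ho S hT hs ht hf hC => ?_
    refine ((runs_writeObl (m := m) (by simp) (by simp) (by simp) hT hn ho.2.1 ho.2.2 hC ht hf).seq
      ((runs_writeObl (m := m) (by simp) (by simp) (by simp) (by simpa using hT) ho.1 ho.2.1 hn
      (by simpa using hs) (by simpa using ht) (by simpa using hC)).seq (runs_push _ _ _))).of_eq
      (by omega) ?_
    funext r
    cases r <;> simp [hC, List.replicate_succ]

/-- Process the formula. -/
def formulaCmd (a : A) : JFrag Γ₁ Reg (StackSym A) σ₁ := loop .inp (fun _ => false) (symbolCmd a)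

theorem runs_formulaCmd (a : A) (x : List FormulaSymbol) {σ : ParseState A} {i m : ℕ}
    (hσ : σ.Bounded i) (hm : i + x.length ≤ m) (out size : List (StackSym A)) :
    (formulaCmd a : JFrag Γ₁ Reg (StackSym A) σ₁).Runs
      (parseRegs σ (x.map formulaSym) out size).get (x.length * (100 * m + 201) + 1)
      (parseRegs (x.foldl (ParseState.step a) σ) [] out size).get ∧
      (x.foldl (ParseState.step a) σ).Bounded m := by
  induction x generalizing σ i with
  | nil =>
    obtain ⟨h1, h2, h3, h4, h5⟩ := hσ
    simp only [List.length_nil] at hm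
    refine ⟨(runs_loop_nil rfl).of_eq (by simp) rfl, h1.trans hm, h2.trans hm, h3.trans hm,
      h4.trans hm, fun o ho => ?_⟩
    have := h5 o ho
    omega
  | cons c x ih =>
    simp only [List.length_cons] at hm
    obtain ⟨h1, h2⟩ := ih (hσ.step a c) (by omega)
    refine ⟨?_, h2⟩
    refine (runs_loop_cons (k := .inp) (f := symbolCmd a) (stops := fun _ => false)
      (S := (parseRegs σ (formulaSym c :: x.map formulaSym) out size).get) rfl rfl
      ((runs_symbolCmd a hσ c (x.map formulaSym) out size).of_start ?_)
      h1).of_eq ?_ rfl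
    · funext r
      cases r <;> simp [parseRegs]
    · have := Nat.succ_mul x.length (100 * m + 201)
      simp only [Nat.succ_eq_add_one, List.length_cons] at this ⊢
      omega

end Frag

-- The reduction as a function on strings

section Reduction

variable {A : Type} (a : A)

/-- The part of an instance that follows the list of edges. -/
def tailString (k : ℕ) : List (QuerySymbol A) :=
  (query a k).encode ++ (encodeList encodeBinding [([], [])] ++
    (encodeName (mainVertex 0) ++ encodeName (mainVertex 1)))

open Classical in
/-- The reduction from weighted satisfiability to query evaluation. -/
noncomputable def reduction (p : List FormulaSymbol × ℕ) : List (QuerySymbol A) × ℕ :=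
  if (p.1.foldl (ParseState.step a) .init).Accepting then
    (encodeList encodeName (vertexList (p.1.foldl (ParseState.step a) .init).next) ++
      (encodeList encodeEdge (p.1.foldl (ParseState.step a) .init).edges ++ tailString a p.2),
      (query a p.2).size)
  else (encodeList encodeEdge (p.1.foldl (ParseState.step a) .init).edges ++ tailString a p.2, 0)

theorem reduction_encode (φ : BoolFormula) (k : ℕ) :
    reduction a (φ.encode, k) = (instanceString a φ k, (query a k).size) := by
  rw [reduction, if_pos ((ParseState.accepting_foldl_init_iff a _).2 ⟨φ, rfl⟩)]
  simp [ParseState.init, ParseState.foldl_step_encode, instanceString, tailString]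

theorem REWB.size_pos (r : REWB A) : 0 < r.size := by
  cases r <;> simp [REWB.size, REWB.encode]

/-- For formulas this is the correctness of the instance. Any other string is sent to some string
with parameter 0, a no-instance because every expression has positive size. -/
theorem mem_weightedSat_iff (p : List FormulaSymbol × ℕ) :
    p ∈ weightedSat ↔ reduction a p ∈ evalE A 1 := by
  obtain ⟨x, k⟩ := p
  by_cases h : ∃ φ : BoolFormula, x = φ.encode
  · constructor
    · rintro ⟨φ, h1, h2⟩
      dsimp only at h1
      subst h1
      rw [reduction_encode, instanceString_mem_evalE]
      exact ⟨rfl, h2⟩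
    · obtain ⟨φ, rfl⟩ := h
      rw [reduction_encode, instanceString_mem_evalE]
      exact fun h => ⟨φ, rfl, h.2⟩
  · refine iff_of_false (fun ⟨φ, h1, _⟩ => h ⟨φ, h1⟩) ?_
    rw [reduction, if_neg (fun h' => h ((ParseState.accepting_foldl_init_iff a x).1 h'))]
    rintro ⟨I, -, -, h3, -⟩
    exact I.expr.size_pos.ne h3

theorem size_query_le [Finite A] (k : ℕ) : (query a k).size ≤ (k + 1) * (3 * (k + 2) ^ 2 + 20) :=
  Frag.length_encode_query a k _ le_rfl

theorem reduction_snd_le [Finite A] (p : List FormulaSymbol × ℕ) :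
    (reduction a p).2 ≤ (p.2 + 1) * (3 * (p.2 + 2) ^ 2 + 20) := by
  rw [reduction]
  split_ifs
  · exact size_query_le a p.2
  · exact Nat.zero_le _

end Reduction

-- Completing the output and the cost of the whole translation

namespace Frag

variable {K₁ : Type} [DecidableEq K₁] {Γ₁ : K₁ → Type} {σ₁ : Type} {A : Type} [Finite A]

/-- Write the list of vertices. -/
def vertexCmd : JFrag Γ₁ Reg (StackSym A) σ₁ :=
  loop .C (fun _ => false) fun _ => emitName .out [some .item, some (.bit false)] .C ⨾
    emitName .out [some .item] .C

theorem runs_vertexCmd {n m : ℕ} (hn : n ≤ m) {S : Reg → List (StackSym A)} (hC : S .C = ones n)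
    (hT : S .T = []) :
    (vertexCmd : JFrag Γ₁ Reg (StackSym A) σ₁).Runs S (n * (10 * m + 12) + 1)
      (Function.update (Function.update S .C []) .out
        (syms ((vertexList n).flatMap fun v => .item :: encodeName v) ++ S .out)) := by
  induction n generalizing S with
  | zero =>
    have h0 : Function.update S .C [] = S := by
      rw [Function.update_eq_self_iff, hC]; rfl
    refine (runs_loop_nil (by simpa using hC)).of_eq (by simp) ?_
    simp [h0, vertexList]
  | succ n ih =>
    refine (runs_loop_cons (by rw [hC, ones, List.replicate_succ]) rfl
      ((runs_emitName _ (m := m) (by simp) (by simp) (by simp) ?_ ?_).seq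
      (runs_emitName _ (m := m) (by simp) (by simp) (by simp) ?_ ?_))
      (ih (by omega) ?_ ?_)).of_eq ?_ ?_
    · simpa using hT
    · simp; omega
    · simpa using hT
    · simp; omega
    · simp
    · simpa using hT
    · have := Nat.succ_mul n (10 * m + 12)
      simp only [Nat.succ_eq_add_one, List.length_cons, List.length_nil] at this ⊢
      omega
    · funext r
      cases r <;> simp [vertexList, List.range_succ, encodeName]

/-- Empty the stacks that are left after an error. -/
def rejectCmd : JFrag Γ₁ Reg (StackSym A) σ₁ :=
  clear .err ⨾ clear .O ⨾ clear .D ⨾ clear .C ⨾ clear .size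

theorem runs_rejectCmd {m : ℕ} {S : Reg → List (StackSym A)} (h1 : (S .err).length ≤ m)
    (h2 : (S .O).length ≤ m) (h3 : (S .D).length ≤ m) (h4 : (S .C).length ≤ m)
    (h5 : (S .size).length ≤ m) :
    (rejectCmd : JFrag Γ₁ Reg (StackSym A) σ₁).Runs S (10 * m + 5)
      (Function.update (Function.update (Function.update (Function.update (Function.update S
        .err []) .O []) .D []) .C []) .size []) :=
  ((runs_clear rfl).seq ((runs_clear rfl).seq ((runs_clear rfl).seq ((runs_clear rfl).seq
    (runs_clear rfl))))).of_eq (by simp; omega) rfl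

/-- Complete the output after the formula has been read. -/
def finishCmd : JFrag Γ₁ Reg (StackSym A) σ₁ :=
  casePop .err fun o => o.elim (casePop .O fun o => o.elim (casePop .D fun o => o.elim
    (pushList .out [some .endList] ⨾ vertexCmd ⨾ move .size .out)
    fun _ => rejectCmd) fun _ => rejectCmd) fun _ => rejectCmd

/-- The counter `C` lists the vertices downwards, each in front of the previous ones. Moving `size`
on top puts the unary parameter before the string, as `encodePair` demands. -/
theorem runs_finishCmd_of_accepting {σ : ParseState A} {m : ℕ} (hσ : σ.Bounded m)
    (h : σ.Accepting) (out : List (StackSym A)) (q : ℕ) :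
    (finishCmd : JFrag Γ₁ Reg (StackSym A) σ₁).Runs
      (parseRegs σ [] out (List.replicate q none)).get (m * (10 * m + 12) + 2 * q + 7)
      ({ out := List.replicate q none ++ (syms (encodeList encodeName (vertexList σ.next)) ++
        (syms (σ.edges.flatMap fun e => .item :: encodeEdge e) ++ out)) } : Regs A).get := by
  obtain ⟨h1, h2, h3⟩ := h
  refine (runs_casePop_nil (by simp [parseRegs, h1]) (runs_casePop_nil (by simp [parseRegs, h2])
    (runs_casePop_nil (by simp [parseRegs, h3]) ((runs_pushList _ _ _).seq
    ((runs_vertexCmd hσ.1 ?_ ?_).seq (runs_move (by simp) rfl)))))).of_eq ?_ ?_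
  · simp [parseRegs]
  · simp [parseRegs]
  · have : σ.next * (10 * m + 12) ≤ m * (10 * m + 12) := Nat.mul_le_mul_right _ hσ.1
    simp [parseRegs]
    omega
  · funext r
    cases r <;> simp [parseRegs, h1, h2, h3, encodeList]

theorem length_flatMap_oblSyms_le {m : ℕ} (os : List (ℕ × ℕ × ℕ))
    (h : ∀ o ∈ os, o.1 ≤ m ∧ o.2.1 ≤ m ∧ o.2.2 ≤ m) :
    (os.flatMap (oblSyms (A := A))).length ≤ os.length * (3 * m + 4) := by
  induction os with
  | nil => simp
  | cons o os ih =>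
    have h1 := ih fun o ho => h o (List.mem_cons_of_mem _ ho)
    have h2 := h o (by simp)
    have := Nat.succ_mul os.length (3 * m + 4)
    simp only [Nat.succ_eq_add_one] at this
    simp only [List.flatMap_cons, oblSyms, List.length_append, List.length_cons,
      List.length_replicate, List.length_nil] at h1 ⊢
    omega

/-- Acceptance fails on one of the stacks `err`, `O`, `D`, and the first nonempty one triggers the
cleanup. Everything but the output is emptied; without the symbols of `size` the parameter is 0. -/
theorem runs_finishCmd_of_not_accepting {σ : ParseState A} {m n : ℕ} (hσ : σ.Bounded m)
    (h : ¬ σ.Accepting) (out : List (StackSym A)) (q : ℕ) (hn : m * (3 * m + 4) + m + q ≤ n) :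
    (finishCmd : JFrag Γ₁ Reg (StackSym A) σ₁).Runs
      (parseRegs σ [] out (List.replicate q none)).get (10 * n + 8)
      ({ out := syms (σ.edges.flatMap fun e => .item :: encodeEdge e) ++ out } : Regs A).get := by
  rcases σ with ⟨os, p, N, es, k⟩
  obtain ⟨h1, h2, h3, h4, h5⟩ := hσ
  have hO := length_flatMap_oblSyms_le (A := A) os h5
  have hO' : os.length * (3 * m + 4) ≤ m * (3 * m + 4) := Nat.mul_le_mul_right _ h3
  simp only at h1 h2 h3 h4
  by_cases hk : k = 0
  swap
  · obtain ⟨k, rfl⟩ := Nat.exists_eq_succ_of_ne_zero hk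
    refine (runs_casePop_cons (s := endSym) (w := List.replicate k endSym)
      (by simp [parseRegs, List.replicate_succ])
      (runs_rejectCmd (m := n) ?_ ?_ ?_ ?_ ?_)).of_eq (by omega) ?_
    case refine_6 =>
      funext r
      cases r <;> simp [parseRegs]
    all_goals first | (simp [parseRegs, -List.length_flatMap]; done) | (simp [parseRegs, -List.length_flatMap]; omega)
  subst hk
  rcases os with _ | ⟨o, os⟩
  swap
  · simp only [List.flatMap_cons, List.length_append] at hO
    have h6 : 1 ≤ (oblSyms o : List (StackSym A)).length := by simp [oblSyms]
    refine (runs_casePop_nil (by simp [parseRegs]) (runs_casePop_cons (s := some .item)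
      (w := (oblSyms o).tail ++ os.flatMap oblSyms) (by simp [parseRegs, oblSyms])
      (runs_rejectCmd (m := n) ?_ ?_ ?_ ?_ ?_))).of_eq (by omega) ?_
    case refine_6 =>
      funext r
      cases r <;> simp [parseRegs]
    all_goals first | (simp [parseRegs, -List.length_flatMap]; done) | (simp [parseRegs, -List.length_flatMap]; omega)
  rcases p with _ | ⟨b, p⟩
  · exact absurd ⟨rfl, rfl, rfl⟩ h
  · simp only [List.length_cons] at h2
    refine (runs_casePop_nil (by simp [parseRegs]) (runs_casePop_nil (by simp [parseRegs])
      (runs_casePop_cons (s := some (.bit b)) (w := p.map fun b => some (.bit b))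
      (by simp [parseRegs])
      (runs_rejectCmd (m := n) ?_ ?_ ?_ ?_ ?_)))).of_eq (by omega) ?_
    case refine_6 =>
      funext r
      cases r <;> simp [parseRegs]
    all_goals first | (simp [parseRegs]; done) | (simp [parseRegs]; omega)

/-- The whole reduction; the input is given in two parts, and the formula in reverse. -/
def reductionCmd (a : A) : JFrag Γ₁ Reg (StackSym A) σ₁ :=
  move .raw .inp ⨾ pushList .out (syms (encodeList encodeBinding [([], [])] ++
    (encodeName (mainVertex 0) ++ encodeName (mainVertex 1)))) ⨾ queryCmd a ⨾
    pushList .out [some .endList] ⨾ pushList .C (ones 3) ⨾ pushList .O (oblSyms (0, 1, 2)) ⨾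
    formulaCmd a ⨾ finishCmd

theorem runs_reductionCmd (a : A) (x : List FormulaSymbol) (k : ℕ) :
    (reductionCmd a : JFrag Γ₁ Reg (StackSym A) σ₁).Runs
      ({ raw := (x.map formulaSym).reverse, ks := List.replicate k none } : Regs A).get
      (1000 * (x.length + k + 3) ^ 3)
      ({ out := encodePair (reduction a (x, k)) } : Regs A).get := by
  set L := x.length + k + 3 with hL
  have hinit : (ParseState.init : ParseState A).Bounded 3 := by
    simp [ParseState.Bounded, ParseState.init]
  obtain ⟨hf, hb⟩ := runs_formulaCmd (Γ₁ := Γ₁) (σ₁ := σ₁) a x hinit (m := L) (by omega)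
    (some .endList :: syms (tailString a k)) (List.replicate (query a k).size none)
  -- The bounds for writing the query are used with `m = L ^ 2`; their factor `k + 1` makes the
  -- total cubic in `L`.
  have hk : (k + 2) ^ 2 ≤ L ^ 2 := Nat.pow_le_pow_left (by omega) 2
  have hq : (query a k).size ≤ (k + 1) * (3 * L ^ 2 + 20) := length_encode_query a k _ hk
  have hfin : (finishCmd : JFrag Γ₁ Reg (StackSym A) σ₁).Runs
      (parseRegs (x.foldl (ParseState.step a) .init) [] (some .endList :: syms (tailString a k))
        (List.replicate (query a k).size none)).get
      (10 * (L * (3 * L + 4) + L + (query a k).size) + 8)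
      ({ out := encodePair (reduction a (x, k)) } : Regs A).get := by
    by_cases hacc : (x.foldl (ParseState.step a) .init).Accepting
    · refine (runs_finishCmd_of_accepting hb hacc _ _).of_eq ?_ ?_
      · nlinarith
      · rw [reduction, if_pos hacc]
        simp [encodePair, encodeList]
    · refine (runs_finishCmd_of_not_accepting hb hacc _ _ le_rfl).of_eq le_rfl ?_
      rw [reduction, if_neg hacc]
      simp [encodePair, encodeList]
  refine ((runs_move (by simp) rfl).seq ((runs_pushList _ _ _).seq
    (((runs_queryCmd a k _ hk (x.map formulaSym) (syms (encodeList encodeBinding [([], [])] ++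
    (encodeName (mainVertex 0) ++ encodeName (mainVertex 1))))).of_start ?_).seq
    ((runs_pushList _ _ _).seq ((runs_pushList _ _ _).seq ((runs_pushList _ _ _).seq
    ((hf.of_start ?_).seq hfin))))))).of_eq ?_ rfl
  · funext r
    cases r <;> simp
  · funext r
    cases r <;> simp [parseRegs, ParseState.init, tailString]
  · have h1 : x.length ≤ L := by omega
    have h2 : k + 1 ≤ L := by omega
    have h3 : x.length * (100 * L + 201) ≤ L * (100 * L + 201) := Nat.mul_le_mul_right _ h1
    have h4 : (k + 1) * (50 * L ^ 2 + 200) ≤ L * (50 * L ^ 2 + 200) := Nat.mul_le_mul_right _ h2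
    have h5 : (query a k).size ≤ L * (3 * L ^ 2 + 20) := hq.trans (Nat.mul_le_mul_right _ h2)
    have h6 : 3 ≤ L := by omega
    simp [encodeList, encodeBinding, encodeName, oblSyms]
    clear_value L
    have h7 : 3 * L ^ 2 ≤ L ^ 3 := by nlinarith [sq_nonneg L]
    have h8 : 3 * L ≤ L ^ 2 := by nlinarith
    nlinarith

end Frag

/-! ### The reduction from an arbitrary problem in W[SAT] -/

namespace Frag

section Transfer

variable {K₁ : Type} [DecidableEq K₁] {Γ₁ : K₁ → Type} {σ₁ : Type} {A : Type}

/-- The stack on which a symbol of an instance of weighted satisfiability is put. -/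
def target (s : StackSym A) : Reg := bif s.isNone then .ks else .raw

/-- Put a symbol of an instance of weighted satisfiability on its stack. -/
def putSym (S : Reg → List (StackSym A)) (s : StackSym A) : Reg → List (StackSym A) :=
  Function.update S (target s) (s :: S (target s))

/-- A symbol of an instance of weighted satisfiability as a stack symbol. -/
def instanceSym (o : Option FormulaSymbol) : StackSym A := o.elim none formulaSym

/-- The symbols `none` of the parameter are collected on `ks` and the formula on `raw`. The latter
comes out reversed, which the first command of `reductionCmd` undoes. -/
theorem foldl_putSym_encodePair (x : List FormulaSymbol) (k : ℕ) :
    ((encodePair (x, k)).map instanceSym).foldl putSym (fun _ => []) =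
      ({ raw := (x.map formulaSym).reverse, ks := List.replicate k none } : Regs A).get := by
  have h1 : ∀ (k : ℕ) (ks : List (StackSym A)),
      (List.replicate k none).foldl putSym ({ ks := ks } : Regs A).get =
        ({ ks := List.replicate k none ++ ks } : Regs A).get := by
    intro k
    induction k with
    | zero => intro ks; rfl
    | succ k ih =>
      intro ks
      have h : putSym ({ ks := ks } : Regs A).get none = ({ ks := none :: ks } : Regs A).get := by
        funext r
        cases r <;> simp [putSym, target]
      rw [List.replicate_succ, List.foldl_cons, h, ih]
      simp [← List.replicate_succ, List.replicate_succ']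
  have h2 : ∀ (x : List FormulaSymbol) (raw ks : List (StackSym A)),
      (x.map formulaSym).foldl putSym ({ raw := raw, ks := ks } : Regs A).get =
        ({ raw := (x.map formulaSym).reverse ++ raw, ks := ks } : Regs A).get := by
    intro x
    induction x with
    | nil => intro raw ks; rfl
    | cons c x ih =>
      intro raw ks
      have h : putSym ({ raw := raw, ks := ks } : Regs A).get (formulaSym c) =
          ({ raw := formulaSym c :: raw, ks := ks } : Regs A).get := by
        funext r
        cases c <;> cases r <;> simp [putSym, target, formulaSym]
      rw [List.map_cons, List.foldl_cons, h, ih]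
      simp
  have h0 : (fun _ => [] : Reg → List (StackSym A)) = ({ ks := [] } : Regs A).get := by
    funext r
    cases r <;> rfl
  have h3 : (encodePair (x, k)).map (instanceSym (A := A)) =
      List.replicate k none ++ x.map formulaSym := by
    simp [encodePair, instanceSym]
  rw [h3, List.foldl_append, h0, h1, h2]
  simp

variable [Finite A]

/-- Distribute the symbols of an instance of weighted satisfiability to the stacks. -/
def transfer (k : K₁) (read : Γ₁ k → StackSym A) : JFrag Γ₁ Reg (StackSym A) σ₁ :=
  loopOn (.inl k) read (fun _ => false) fun s => push (target s) s

theorem run_transfer {k : K₁} {read : Γ₁ k → StackSym A} {w : List (Γ₁ k)} {v : σ₁ × Option (StackSym A)}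
    {S₁ : ∀ k, List (Γ₁ k)} {S : Reg → List (StackSym A)} (hw : S₁ k = w) :
    ∃ v', ∃ m ≤ 2 * w.length + 1, (transfer k read).Run (some (transfer k read : JFrag Γ₁ _ _ σ₁).entry)
      v (stk S₁ S) m v' (stk (Function.update S₁ k []) ((w.map read).foldl putSym S)) := by
  induction w generalizing v S₁ S with
  | nil =>
    have h0 : Function.update S₁ k [] = S₁ := by simp [← hw]
    rw [h0]
    exact ⟨_, 1, by simp, run_loopOn_nil (κ := .inl k) (S := stk S₁ S) hw⟩
  | cons s w ih =>
    obtain ⟨v₁, n, hn, h1⟩ := runs_push (Γ₁ := Γ₁) (σ₁ := σ₁) (target (read s)) (read s) S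
      (v.1, some (read s)) (Function.update S₁ k w)
    obtain ⟨v₂, m, hm, h2⟩ := ih (v := v₁) (S₁ := Function.update S₁ k w) (S := putSym S (read s))
      (by simp)
    rw [← update_stk_inl] at h1
    rw [Function.update_idem] at h2
    refine ⟨v₂, n + m + 1, ?_, run_loopOn_cons (κ := .inl k) (S := stk S₁ S) hw rfl h1 h2⟩
    simp only [List.length_cons]
    omega

end Transfer

section Total

variable {Γ A : Type} [Finite A] (a : A) (M : TM2ComputableAux (Option Γ) (Option FormulaSymbol))

/-- Run the machine `M`, and then the reduction from weighted satisfiability. -/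
def totalCmd : JFrag M.tm.Γ Reg (StackSym A) M.tm.σ :=
  ofMachine M.tm Reg (StackSym A) ⨾
    transfer M.tm.k₁ (fun γ => instanceSym (M.outputAlphabet γ)) ⨾ reductionCmd a

/-- The machine that computes the composition. -/
noncomputable def totalMachine : TM2ComputableAux (Option Γ) (StackSym A) where
  tm := toMachine M.tm (totalCmd a M) .out
  inputAlphabet := M.inputAlphabet
  outputAlphabet := Equiv.refl _

theorem exists_pushes_le (M : FinTM2) : ∃ B, ∀ l, (M.m l).pushes ≤ B := by
  have := M.ΛFin
  exact ⟨Finset.univ.sup fun l => (M.m l).pushes,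
    fun l => Finset.le_sup (f := fun l => (M.m l).pushes) (Finset.mem_univ l)⟩

/-- The output stack may be the input stack, so the length of the input is added to the symbols
pushed in `T` steps. -/
theorem length_output_le {M : FinTM2} {B : ℕ} (hB : ∀ l, (M.m l).pushes ≤ B)
    {s : List (M.Γ M.k₀)} {s' : List (M.Γ M.k₁)} {T : ℕ} (h : TM2OutputsInTime M s (some s') T) :
    s'.length ≤ s.length + T * B := by
  have h1 := TM2.length_iterate_step_le (K := M.K) (Γ := M.Γ) (σ := M.σ) M.m B hB M.k₁ h.steps _ _ h.evals_in_steps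
  have h2 : ((initList M s).stk M.k₁).length ≤ s.length := by
    by_cases hk : M.k₁ = M.k₀
    · rw [hk, stk_initList_self]
    · simp [stk_initList_of_ne M s hk]
  have h3 := Nat.mul_le_mul_right B h.steps_le_m
  rw [stk_haltList_self] at h1
  omega

theorem length_encodePair {Δ : Type} (p : List Δ × ℕ) :
    (encodePair p).length = p.2 + p.1.length := by
  simp [encodePair]

theorem totalMachine_outputs {p : List Γ × ℕ} {q : List FormulaSymbol × ℕ} {T L T' : ℕ}
    (h : TM2OutputsInTime M.tm ((encodePair p).map M.inputAlphabet.symm)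
      (some ((encodePair q).map M.outputAlphabet.symm)) T)
    (hL : q.1.length + q.2 ≤ L) (hT : T + (2 * L + 1) + 1000 * (L + 3) ^ 3 + 1 ≤ T') :
    Nonempty (TM2OutputsInTime (totalMachine a M).tm
      ((encodePair p).map (totalMachine a M).inputAlphabet.symm)
      (some ((encodePair (reduction a q)).map (totalMachine a M).outputAlphabet.symm)) T') := by
  obtain ⟨x, k⟩ := q
  have r1 := run_ofMachine M.tm (fun _ : Reg => []) (none : Option (StackSym A)) h.steps _ _ rfl
    h.evals_in_steps
  obtain ⟨v₂, n₂, hn₂, r2⟩ := run_transfer (k := M.tm.k₁) (A := A)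
    (read := fun γ => instanceSym (M.outputAlphabet γ)) (v := (M.tm.initialState, none))
    (S := fun _ => []) (stk_haltList_self M.tm ((encodePair (x, k)).map M.outputAlphabet.symm))
  have he : Function.update (haltList M.tm ((encodePair (x, k)).map M.outputAlphabet.symm)).stk
      M.tm.k₁ [] = fun _ => [] := by
    funext k'
    by_cases hk : k' = M.tm.k₁
    · subst hk; simp
    · rw [Function.update_of_ne hk, stk_haltList_of_ne _ _ hk]
  have hm : ((encodePair (x, k)).map M.outputAlphabet.symm).map
      (fun γ => instanceSym (A := A) (M.outputAlphabet γ)) = (encodePair (x, k)).map instanceSym := by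
    simp
  rw [he, hm, foldl_putSym_encodePair] at r2
  obtain ⟨v₃, n₃, hn₃, r3⟩ := runs_reductionCmd (Γ₁ := M.tm.Γ) (σ₁ := M.tm.σ) a x k v₂ fun _ => []
  have ho : ({ out := encodePair (reduction a (x, k)) } : Regs A).get =
      Function.update (fun _ : Reg => ([] : List (StackSym A))) .out (encodePair (reduction a (x, k))) := by
    funext r
    cases r <;> simp
  rw [ho] at r3
  have hr := r1.seq (r2.seq r3)
  have hout := toMachine_outputs M.tm (totalCmd a M) .out _ _ hr (T := T') ?_
  · have hid : (encodePair (reduction a (x, k))).map (totalMachine a M).outputAlphabet.symm =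
        encodePair (reduction a (x, k)) := List.map_id _
    rw [hid]
    exact hout
  · simp only [List.length_map, length_encodePair] at hn₂
    have h4 : 1000 * (x.length + k + 3) ^ 3 ≤ 1000 * (L + 3) ^ 3 := by gcongr
    have h5 := h.steps_le_m
    simp only at hL
    omega

end Total

end Frag

-- Computability and time bounds of the composition

theorem computable_add {f g : ℕ → ℕ} (hf : Computable f) (hg : Computable g) :
    Computable fun n => f n + g n := Primrec.nat_add.to_comp.comp hf hg

theorem computable_mul {f g : ℕ → ℕ} (hf : Computable f) (hg : Computable g) :
    Computable fun n => f n * g n := Primrec.nat_mul.to_comp.comp hf hg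

/-- Here `f` is the value at the parameter of the factor in the given time bound, and `L` bounds the
size of the intermediate instance. The cubic cost of the translation triples the exponent. -/
theorem reduction_time_le (f B n k c : ℕ) :
    let L := k + n + f * (n + 1) ^ c * B
    let g := k + f * B + 4
    f * (n + 1) ^ c + (2 * L + 1) + 1000 * (L + 3) ^ 3 + 1 ≤
      (f + 2 * g + 2 + 1000 * (g * (g * g))) * (n + 1) ^ (3 * (c + 1)) := by
  intro L g
  have hLd : L = k + n + f * (n + 1) ^ c * B := rfl
  have hgd : g = k + f * B + 4 := rfl
  clear_value L g
  have hX : 1 ≤ n + 1 := Nat.le_add_left 1 n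
  have hc : (n + 1) ^ c ≤ (n + 1) ^ (c + 1) := Nat.pow_le_pow_right hX (Nat.le_succ c)
  have h1 : n + 1 ≤ (n + 1) ^ (c + 1) := Nat.le_self_pow (Nat.succ_ne_zero c) _
  have h3 : (n + 1) ^ (c + 1) ≤ (n + 1) ^ (3 * (c + 1)) :=
    Nat.pow_le_pow_right hX (by omega)
  have hcube : (n + 1) ^ (3 * (c + 1)) = ((n + 1) ^ (c + 1)) ^ 3 := by rw [mul_comm, pow_mul]
  generalize (n + 1) ^ (c + 1) = Y at *
  generalize (n + 1) ^ c = Z at *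
  rw [hcube] at h3 ⊢
  -- The exponent `c + 1` is used because `Y` has to dominate both `n + 1` and `(n + 1) ^ c`, also
  -- for `c = 0`; the summand 4 in `g` absorbs `n + 3`.
  have hL : L + 3 ≤ g * Y := by
    have : f * Z * B ≤ f * B * Y := by
      calc f * Z * B = f * B * Z := by ring
        _ ≤ f * B * Y := Nat.mul_le_mul_left _ hc
    rw [hLd, hgd]
    nlinarith [Nat.mul_le_mul_left k ((Nat.le_add_left 1 n).trans h1)]
  have h4 : (L + 3) ^ 3 ≤ (g * Y) ^ 3 := Nat.pow_le_pow_left hL 3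
  have h5 : f * Z ≤ f * Y ^ 3 := Nat.mul_le_mul_left _ (hc.trans h3)
  have h6 : g * Y ≤ g * Y ^ 3 := Nat.mul_le_mul_left _ h3
  have h7 : (g * Y) ^ 3 = g * (g * g) * Y ^ 3 := by ring
  rw [h7] at h4
  nlinarith

theorem IsFPTReduction.comp_reduction (A : Type) [Finite A] (a : A) {Γ : Type} {Q : ParamProblem Γ}
    {R : List Γ × ℕ → List FormulaSymbol × ℕ} (hR : IsFPTReduction Q weightedSat R) :
    IsFPTReduction Q (evalE A 1) fun p => reduction a (R p) where
  correct p := (hR.correct p).trans (mem_weightedSat_iff a (R p))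
  param_le := by
    obtain ⟨g, hg, h⟩ := hR.param_le
    have c : ∀ n : ℕ, Computable fun _ : ℕ => n := fun n => Computable.const n
    have h2 := computable_add hg (c 2)
    refine ⟨fun n => (g n + 1) * (3 * ((g n + 2) * (g n + 2)) + 20),
      computable_mul (computable_add hg (c 1))
        (computable_add (computable_mul (c 3) (computable_mul h2 h2)) (c 20)), fun p => ?_⟩
    refine (reduction_snd_le a (R p)).trans ?_
    rw [pow_two]
    have := h p
    change _ ≤ (g p.2 + 1) * (3 * ((g p.2 + 2) * (g p.2 + 2)) + 20)
    gcongr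
  fpt_time := by
    obtain ⟨M, f, c, hf, hM⟩ := hR.fpt_time
    obtain ⟨B, hB⟩ := Frag.exists_pushes_le M.tm
    have cc : ∀ n : ℕ, Computable fun _ : ℕ => n := fun n => Computable.const n
    have hg : Computable fun n => n + f n * B + 4 :=
      computable_add (computable_add Computable.id (computable_mul hf (cc B))) (cc 4)
    refine ⟨Frag.totalMachine a M, fun k => f k + 2 * (k + f k * B + 4) + 2 +
      1000 * ((k + f k * B + 4) * ((k + f k * B + 4) * (k + f k * B + 4))), 3 * (c + 1),
      computable_add (computable_add (computable_add hf (computable_mul (cc 2) hg)) (cc 2))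
        (computable_mul (cc 1000) (computable_mul hg (computable_mul hg hg))), fun p => ?_⟩
    obtain ⟨h⟩ := hM p
    refine Frag.totalMachine_outputs a M h (L := p.2 + p.1.length + f p.2 * (p.1.length + 1) ^ c * B)
      ?_ (reduction_time_le (f p.2) B p.1.length p.2 c)
    have := Frag.length_output_le hB h
    simp only [List.length_map, Frag.length_encodePair] at this
    omega

theorem mainTheorem5 (A : Type) [Finite A] [Nonempty A] : IsWSATHard (evalE A 1) := by
  intro Γ _ Q ⟨R, hR⟩
  exact ⟨_, IsFPTReduction.comp_reduction A (Classical.arbitrary A) hR⟩
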